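/- Let $n$ be a positive integer, let $\mathrm{Par}(n)$ be the set of partitions of $n$ with the dominance order $\trianglelefteq$, and for $\lambda\in\mathrm{Par}(n)$ let $\lambda^*$ be the transpose partition; for $\Gamma\subseteq\mathrm{Par}(n)$ put $\Gamma^*=\{\lambda^*\mid\lambda\in\Gamma\}$. For $\lambda=(\lambda_1,\dots,\lambda_m)\in\mathrm{Par}(n)$ let $\mathrm{Sym}(\lambda)=\mathrm{Sym}(X_1)\times\cdots\times\mathrm{Sym}(X_m)\le\mathrm{Sym}(n)$, where $X_1=\{1,\dots,\lambda_1\}$, $X_2=\{\lambda_1+1,\dots,\lambda_1+\lambda_2\}$, and so on. Let $R$ be a commutative ring. For $\Delta\subseteq\mathrm{Par}(n)$ let $I_R(\Delta)$ be the two-sided ideal of the group algebra $R\,\mathrm{Sym}(n)$ generated by the elements $\sum_{\sigma\in\mathrm{Sym}(\lambda)}\sigma$, $\lambda\in\Delta$, and let ${}^\dagger$ be the $R$-algebra automorphism of $R\,\mathrm{Sym}(n)$ with $\sigma^\dagger=\mathrm{sgn}(\sigma)\sigma$ for $\sigma\in\mathrm{Sym}(n)$. For $\Gamma\subseteq\mathrm{Par}(n)$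 let $G(\Gamma)$ be the set of permutations $\sigma\in\mathrm{Sym}(n)$ such that the shape of the tableaux attached to the word $\sigma(1)\sigma(2)\cdots\sigma(n)$ by the Robinson–Schensted correspondence lies in $\Gamma$, and let $RG(\Gamma)$ be the $R$-span of $G(\Gamma)$ in $R\,\mathrm{Sym}(n)$. Let $M(\lambda)_R$ be the permutation module of $R\,\mathrm{Sym}(n)$ on the cosets $\mathrm{Sym}(n)/\mathrm{Sym}(\lambda)$. A left $R\,\mathrm{Sym}(n)$-module $M$ is a Young permutation module of type $\Gamma$ if $M\cong\bigoplus_{\lambda\in\mathrm{Par}(n)}M(\lambda)_R^{\oplus u_\lambda}$ for some non-negative integers $u_\lambda$ such that $u_\lambda\ne0$ if and only if $\lambda\in\Gamma$. Let $\Gamma\subseteq\mathrm{Par}(n)$ be co-saturated (if $\mu\in\Gamma$ and $\mu\trianglelefteq\lambda$ then $\lambda\in\Gamma$) with a unique minimal element, let $M$ be a Young permutation module for $R\,\mathrm{Sym}(n)$ of type $\Gamma$, and let $\rho_R:R\,\mathrm{Sym}(n)\to\mathrm{End}_R(M)$ be the corresponding representation. Then: (i) The restriction $\theta_R:RG(\Gamma)\to\mathrm{End}_R(M)$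 of $\rho_R$ is injective. (ii) The annihilator $\mathrm{Ann}(M)$ of $M$ in $R\,\mathrm{Sym}(n)$ is $I_R(\Delta)^\dagger=\{d^\dagger\mid d\in I_R(\Delta)\}$, where $\Delta=\mathrm{Par}(n)\setminus\Gamma^*$. Consequently, the elements $\sigma+\mathrm{Ann}(M)$, $\sigma\in G(\Gamma)$, form an $R$-basis of $R\,\mathrm{Sym}(n)/\mathrm{Ann}(M)$. -/

import Mathlib

namespace YoungPerm

/-! ### Partitions: dominance order and transpose -/

/-- `rowSum p k = p₁ + ⋯ + p_k`, where `p₁ ≥ p₂ ≥ ⋯` are the parts of `p` in weakly decreasing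
order (and `p_i = 0` beyond the number of parts). -/
def rowSum {n : ℕ} (p : n.Partition) (k : ℕ) : ℕ :=
  ((p.parts.sort (· ≥ ·)).take k).sum

theorem list_eq_of_take_sum_eq : ∀ (l m : List ℕ), (∀ x ∈ l, 0 < x) → (∀ x ∈ m, 0 < x) →
    (∀ k, (l.take k).sum = (m.take k).sum) → l = m
  | [], [], _, _, _ => rfl
  | [], b :: m, _, hm, h => by
      have h1 := h 1
      have := hm b (by simp)
      simp at h1
      omega
  | a :: l, [], hl, _, h => by
      have h1 := h 1
      have := hl a (by simp)
      simp at h1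
      omega
  | a :: l, b :: m, hl, hm, h => by
      have hab : a = b := by simpa using h 1
      subst hab
      congr 1
      refine list_eq_of_take_sum_eq l m (fun x hx => hl x (by simp [hx]))
        (fun x hx => hm x (by simp [hx])) (fun k => ?_)
      simpa using h (k + 1)

/-- The dominance order on partitions of `n`. -/
instance dominance (n : ℕ) : PartialOrder n.Partition where
  le p q := ∀ k, rowSum p k ≤ rowSum q k
  le_refl _ _ := le_rfl
  le_trans _ _ _ h₁ h₂ k := (h₁ k).trans (h₂ k)
  le_antisymm p q h₁ h₂ := by
    have key : p.parts.sort (· ≥ ·) = q.parts.sort (· ≥ ·) :=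
      list_eq_of_take_sum_eq _ _
        (fun x hx => p.parts_pos ((Multiset.mem_sort (· ≥ ·)).1 hx))
        (fun x hx => q.parts_pos ((Multiset.mem_sort (· ≥ ·)).1 hx))
        (fun k => le_antisymm (h₁ k) (h₂ k))
    apply Nat.Partition.ext
    rw [← Multiset.sort_eq p.parts (· ≥ ·), ← Multiset.sort_eq q.parts (· ≥ ·), key]

theorem sum_range_countP (n : ℕ) (s : Multiset ℕ) (hs : ∀ x ∈ s, x ≤ n) :
    ((Multiset.range n).map (fun j => s.countP (fun x => j < x))).sum = s.sum := by
  change ∑ j ∈ Finset.range n, s.countP (fun x => j < x) = s.sum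
  induction s using Multiset.induction with
  | empty => simp
  | cons a s ih =>
    have ha : a ≤ n := hs a (by simp)
    have h2 : ∑ j ∈ Finset.range n, (if j < a then 1 else 0) = a := by
      rw [← Finset.card_filter]
      have : (Finset.range n).filter (fun j => j < a) = Finset.range a := by
        ext j
        simp only [Finset.mem_filter, Finset.mem_range]
        omega
      rw [this, Finset.card_range]
    simp only [Multiset.countP_cons, Finset.sum_add_distrib, Multiset.sum_cons]
    rw [ih (fun x hx => hs x (by simp [hx])), h2, add_comm]

/-- The dual (transpose) partition: its `j`-th part (`j = 0, 1, …`) is the number of parts of `p`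
that exceed `j`; zeros are discarded. -/
def transpose {n : ℕ} (p : n.Partition) : n.Partition :=
  Nat.Partition.ofSums n ((Multiset.range n).map (fun j => p.parts.countP (fun x => j < x)))
    ((sum_range_countP n p.parts (fun _ hx => Nat.Partition.le_of_mem_parts hx)).trans p.parts_sum)

/-! ### The Robinson–Schensted shape of a permutation -/

/-- Schensted insertion of `x` into a row: `x` replaces the first entry greater than `x`, which
is bumped out (second component), or is appended if there is none. -/
def rowInsert {α : Type*} [LinearOrder α] (x : α) : List α → List α × Option α
  | [] => ([x], none)
  | y :: ys => if x < y then (x :: ys, some y) else (y :: (rowInsert x ys).1, (rowInsert x ys).2)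

/-- Insertion of `x` into a tableau (a list of rows): the entry bumped from a row is inserted
into the next row. -/
def tableauInsert {α : Type*} [LinearOrder α] (x : α) : List (List α) → List (List α)
  | [] => [[x]]
  | r :: rs =>
    match rowInsert x r with
    | (r', none) => r' :: rs
    | (r', some y) => r' :: tableauInsert y rs

/-- The insertion tableau of a word, obtained by inserting its letters from left to right into the
empty tableau. -/
def insertionTableau {α : Type*} [LinearOrder α] (w : List α) : List (List α) :=
  w.foldl (fun T x => tableauInsert x T) []

theorem rowInsert_length {α : Type*} [LinearOrder α] (x : α) (r : List α) :
    (rowInsert x r).1.length + (rowInsert x r).2.toList.length = r.length + 1 := by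
  induction r with
  | nil => simp [rowInsert]
  | cons y ys ih =>
    unfold rowInsert
    split_ifs
    · simp
    · simp only [List.length_cons]
      omega

theorem tableauInsert_size {α : Type*} [LinearOrder α] (T : List (List α)) :
    ∀ x : α, ((tableauInsert x T).map List.length).sum = (T.map List.length).sum + 1 := by
  induction T with
  | nil => intro x; simp [tableauInsert]
  | cons r rs ih =>
    intro x
    have h := rowInsert_length x r
    unfold tableauInsert
    split
    · next r' heq =>
      rw [heq] at h
      simp at h
      simp only [List.map_cons, List.sum_cons]
      omega
    · next r' y heq =>
      rw [heq] at h
      simp at h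
      simp only [List.map_cons, List.sum_cons, ih]
      omega

theorem insertionTableau_size {α : Type*} [LinearOrder α] (w : List α) :
    ((insertionTableau w).map List.length).sum = w.length := by
  have aux : ∀ (w : List α) (T : List (List α)),
      ((w.foldl (fun T x => tableauInsert x T) T).map List.length).sum
        = (T.map List.length).sum + w.length := by
    intro w
    induction w with
    | nil => intro T; simp
    | cons x xs ih =>
      intro T
      simp only [List.foldl_cons, List.length_cons, ih, tableauInsert_size]
      omega
  simpa [insertionTableau] using aux w []

/-- The Robinson–Schensted shape of `σ`: the partition of `n` given by the row lengths of the
insertion tableau of the word `σ(1) σ(2) … σ(n)`. -/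
def rsShape {n : ℕ} (σ : Equiv.Perm (Fin n)) : n.Partition :=
  Nat.Partition.ofSums n
    (((insertionTableau (List.ofFn fun i => σ i)).map List.length : List ℕ) : Multiset ℕ)
    (by rw [Multiset.sum_coe, insertionTableau_size, List.length_ofFn])

/-- `G(Γ)`: the permutations whose Robinson–Schensted shape lies in `Γ`. -/
def permsOfShape {n : ℕ} (Γ : Set n.Partition) : Set (Equiv.Perm (Fin n)) :=
  {σ | rsShape σ ∈ Γ}

/-! ### Young subgroups, the ideals `I_R(Δ)` and the sign automorphism -/

/-- The `r`-th block of consecutive elements determined by `p` (`r = 0, 1, …`):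
`{p₁ + ⋯ + p_r + 1, …, p₁ + ⋯ + p_{r+1}}`, shifted by one because `Fin n` starts at `0`. -/
def block {n : ℕ} (p : n.Partition) (r : ℕ) : Set (Fin n) :=
  {i | rowSum p r ≤ (i : ℕ) ∧ (i : ℕ) < rowSum p (r + 1)}

/-- The Young subgroup `Sym(p)`: the permutations that preserve every block of `p`. -/
def youngSubgroup {n : ℕ} (p : n.Partition) : Subgroup (Equiv.Perm (Fin n)) where
  carrier := {σ | ∀ r i, σ i ∈ block p r ↔ i ∈ block p r}
  mul_mem' {σ τ} hσ hτ r i := (hσ r (τ i)).trans (hτ r i)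
  one_mem' _ _ := Iff.rfl
  inv_mem' {σ} hσ r i := by
    have h := hσ r (σ⁻¹ i)
    have e : σ (σ⁻¹ i) = i := Equiv.apply_symm_apply σ i
    rw [e] at h
    exact h.symm

/-- The group algebra `R Sym(n)`. -/
abbrev SymAlg (R : Type*) [CommRing R] (n : ℕ) : Type _ :=
  MonoidAlgebra R (Equiv.Perm (Fin n))

open Classical in
/-- `[H] = ∑_{h ∈ H} h` for `H = Sym(p)`. -/
noncomputable def youngSum (R : Type*) [CommRing R] {n : ℕ} (p : n.Partition) : SymAlg R n :=
  ∑ σ : Equiv.Perm (Fin n) with σ ∈ youngSubgroup p, MonoidAlgebra.of R _ σ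

/-- `I_R(Δ)`: the two-sided ideal of `R Sym(n)` generated by the `[Sym(p)]`, `p ∈ Δ`. -/
noncomputable def youngIdeal (R : Type*) [CommRing R] {n : ℕ} (Δ : Set n.Partition) :
    TwoSidedIdeal (SymAlg R n) :=
  TwoSidedIdeal.span (youngSum R '' Δ)

/-- The algebra endomorphism `†` of `R Sym(n)` (in fact an automorphism) given by
`σ ↦ sgn(σ) σ`. -/
noncomputable def dagger (R : Type*) [CommRing R] (n : ℕ) : SymAlg R n →ₐ[R] SymAlg R n :=
  MonoidAlgebra.lift R (SymAlg R n) (Equiv.Perm (Fin n))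
    { toFun := fun σ => ((Equiv.Perm.sign σ : ℤˣ) : ℤ) • MonoidAlgebra.of R _ σ
      map_one' := by rw [map_one, map_one, Units.val_one, one_smul]
      map_mul' := fun σ τ => by
        rw [map_mul, map_mul, Units.val_mul, smul_mul_smul_comm] }

/-- `R G(Γ)`: the `R`-span of `G(Γ)` in `R Sym(n)`. -/
noncomputable def shapeSpan (R : Type*) [CommRing R] {n : ℕ} (Γ : Set n.Partition) :
    Submodule R (SymAlg R n) :=
  Submodule.span R (MonoidAlgebra.of R (Equiv.Perm (Fin n)) '' permsOfShape Γ)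

/-! ### Young permutation modules -/

/-- `M(p)_R`: the permutation module of `R Sym(n)` on the cosets `Sym(n)/Sym(p)`. -/
abbrev PermModule (R : Type*) [CommRing R] {n : ℕ} (p : n.Partition) : Type _ :=
  (Representation.ofMulAction R (Equiv.Perm (Fin n))
    (Equiv.Perm (Fin n) ⧸ youngSubgroup p)).asModule

open scoped DirectSum in
/-- `M` is a Young permutation module of type `Γ`: it is isomorphic to `⨁ₚ M(p)^{u_p}` for some
multiplicities `u_p`, with `u_p ≠ 0` exactly for `p ∈ Γ`. -/
def IsYoungPermModuleOfType (R : Type*) [CommRing R] {n : ℕ} (Γ : Set n.Partition)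
    (M : Type*) [AddCommGroup M] [Module (SymAlg R n) M] : Prop :=
  ∃ u : n.Partition → ℕ, (∀ p, u p ≠ 0 ↔ p ∈ Γ) ∧
    Nonempty (M ≃ₗ[SymAlg R n] ⨁ p : n.Partition, (Fin (u p) → PermModule R p))

end YoungPerm

/-!
An element of `R Sym(n)` kills `M(p)` if and only if all its matrix coefficients on `M(p)` vanish;
here a coset of `Sym(p)` is a function `Fin n → ℕ` whose fibre sizes are the parts of `p`. For a
signed Young sum of type `p` and functions of shape `q`, two points with the same `p`-block and the
same `q`-value make the summands of the coefficient cancel in pairs, and such points exist unless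
`q ⊴ p*`. Hence `I_R(Δ)† ⊆ Ann(M)`.

Let `μ` be the minimum of `Γ`. If the shape of `σ` does not dominate `μ`, Greene's theorem on `k`
disjoint decreasing subsequences, in the direction that follows from Knuth moves, yields a signed
sum in `I_R(Δ)†` whose product with `σ` is `σ` plus lexicographically smaller terms. So
`R G(Γ) + I_R(Δ)†` is everything.

Conversely, the rows of the recording and insertion tableaux of `σ ∈ G(Γ)` give a matrix coefficient
vanishing on `Ann(M)`, and their columns give an element of `R Sym(n)`; the pairing between these is
unitriangular for the dominance order on pairs of tabloids. Thus `R Sym(n)` maps onto `R^{G(Γ)}`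
with `Ann(M)` in the kernel. As a surjective endomorphism of `R^{G(Γ)}` is injective, `G(Γ)` is
linearly independent and spans a complement of `Ann(M)`, which forces `Ann(M) = I_R(Δ)†`.
-/

namespace YoungPerm

open Finset

/-! ### Parts, row sums and transposition -/

section Partitions

variable {n : ℕ}

/-- The `i`-th part of `p` (`i = 0, 1, …`) in weakly decreasing order, `0` beyond the last one. -/
def part (p : n.Partition) (i : ℕ) : ℕ := (p.parts.sort (· ≥ ·)).getD i 0

theorem antitone_getD_of_pairwise {l : List ℕ} (hl : l.Pairwise (· ≥ ·)) :
    Antitone (fun i => l.getD i 0) := by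
  refine antitone_nat_of_succ_le fun i => ?_
  by_cases hi : i + 1 < l.length
  · simp only [List.getD_eq_getElem _ _ hi, List.getD_eq_getElem _ _ (Nat.lt_of_succ_lt hi)]
    exact List.pairwise_iff_getElem.1 hl i (i + 1) _ _ i.lt_succ_self
  · simp only [List.getD_eq_default _ _ (not_lt.1 hi), Nat.zero_le]

theorem lt_countP_iff_lt_getD {l : List ℕ} (hl : l.Pairwise (· ≥ ·)) (i j : ℕ) :
    i < l.countP (j < ·) ↔ j < l.getD i 0 := by
  induction l generalizing i with
  | nil => simp
  | cons a l ih =>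
    by_cases ha : j < a
    · cases i with
      | zero => simp [ha]
      | succ i => simpa [ha] using ih hl.of_cons i
    · have getD_le : (a :: l).getD i 0 ≤ a := antitone_getD_of_pairwise hl i.zero_le
      have countP_eq : (a :: l).countP (j < ·) = 0 := by
        simp only [List.countP_eq_zero, decide_eq_true_eq]
        exact fun x hx => not_lt.2 (((List.mem_cons.1 hx).elim (·.le)
          ((List.pairwise_cons.1 hl).1 x)).trans (not_lt.1 ha))
      omega

theorem part_antitone (p : n.Partition) : Antitone (part p) :=
  antitone_getD_of_pairwise (Multiset.pairwise_sort _ _)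

theorem lt_part_iff (p : n.Partition) (i j : ℕ) :
    j < part p i ↔ i < p.parts.countP (j < ·) := by
  rw [part, ← lt_countP_iff_lt_getD (Multiset.pairwise_sort _ _), ← Multiset.coe_countP,
    Multiset.sort_eq]

theorem part_ofSums {l : List ℕ} (hl : l.Pairwise (· ≥ ·)) (hsum : (l : Multiset ℕ).sum = n)
    (i : ℕ) : part (Nat.Partition.ofSums n l hsum) i = l.getD i 0 := by
  refine eq_of_forall_lt_iff fun j => ?_
  rw [lt_part_iff, ← lt_countP_iff_lt_getD hl, Nat.Partition.ofSums_parts, Multiset.countP_filter,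
    ← Multiset.coe_countP]
  refine iff_of_eq (congrArg (i < ·) (Multiset.countP_congr rfl fun x _ => ?_))
  exact propext ⟨And.left, fun hx => ⟨hx, (Nat.zero_le j).trans_lt hx |>.ne'⟩⟩

theorem part_transpose (p : n.Partition) (j : ℕ) :
    part (transpose p) j = p.parts.countP (j < ·) := by
  have sorted : ((List.range n).map fun j => p.parts.countP (j < ·)).Pairwise (· ≥ ·) := by
    refine List.pairwise_map.2 (List.pairwise_lt_range.imp fun {a b} hab => ?_)
    simp only [Multiset.countP_eq_card_filter]
    exact Multiset.card_le_card (Multiset.monotone_filter_right _ fun x hx => hab.trans hx)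
  refine (part_ofSums sorted _ j).trans ?_
  by_cases hj : j < n
  · simp [hj]
  · rw [List.getD_eq_default _ _ (by simpa using hj), eq_comm, Multiset.countP_eq_zero]
    exact fun x hx => not_lt.2 ((Nat.Partition.le_of_mem_parts hx).trans (not_lt.1 hj))

theorem lt_part_transpose_iff (p : n.Partition) (i j : ℕ) :
    i < part (transpose p) j ↔ j < part p i := by
  rw [part_transpose, lt_part_iff]

theorem rowSum_eq_sum_part (p : n.Partition) (k : ℕ) : rowSum p k = ∑ i ∈ range k, part p i := by
  suffices ∀ l : List ℕ, (l.take k).sum = ∑ i ∈ range k, l.getD i 0 from this _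
  intro l
  induction l generalizing k with
  | nil => simp
  | cons a l ih => cases k <;> simp [sum_range_succ', ih, add_comm]

theorem part_injective : Function.Injective (part : n.Partition → ℕ → ℕ) := fun p q h =>
  le_antisymm (fun k => by rw [rowSum_eq_sum_part, rowSum_eq_sum_part, h])
    (fun k => by rw [rowSum_eq_sum_part, rowSum_eq_sum_part, h])

theorem transpose_transpose (p : n.Partition) : transpose (transpose p) = p :=
  part_injective <| funext fun i => eq_of_forall_lt_iff fun j => by
    rw [lt_part_transpose_iff, lt_part_transpose_iff]

theorem rowSum_mono (p : n.Partition) : Monotone (rowSum p) := fun a b hab => by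
  rw [rowSum_eq_sum_part, rowSum_eq_sum_part]
  exact sum_le_sum_of_subset (range_subset_range.2 hab)

theorem card_parts_le (p : n.Partition) : p.parts.card ≤ n := by
  simpa [p.parts_sum] using
    Multiset.card_nsmul_le_sum (s := p.parts) (a := 1) fun x hx => p.parts_pos hx

theorem rowSum_of_le (p : n.Partition) {N : ℕ} (hN : n ≤ N) : rowSum p N = n := by
  rw [rowSum, List.take_of_length_le (by simpa using (card_parts_le p).trans hN),
    ← Multiset.sum_coe, Multiset.sort_eq, p.parts_sum]

theorem rowSum_le (p : n.Partition) (k : ℕ) : rowSum p k ≤ n :=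
  (rowSum_mono p (Nat.le_add_left k n)).trans_eq (rowSum_of_le p (Nat.le_add_right n k))

theorem part_le (p : n.Partition) (i : ℕ) : part p i ≤ n :=
  (single_le_sum (fun _ _ => Nat.zero_le _) (self_mem_range_succ i)).trans
    ((rowSum_eq_sum_part p (i + 1)).symm.trans_le (rowSum_le p _))

theorem lt_of_part_ne_zero {p : n.Partition} {i : ℕ} (hi : part p i ≠ 0) : i < n :=
  ((lt_part_transpose_iff p i 0).2 (Nat.pos_of_ne_zero hi)).trans_le (part_le _ _)

theorem rowSum_transpose (p : n.Partition) (k : ℕ) :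
    rowSum (transpose p) k = ∑ i ∈ range n, min k (part p i) := by
  calc rowSum (transpose p) k
      = ∑ j ∈ range k, #{i ∈ range n | j < part p i} := by
        rw [rowSum_eq_sum_part]
        refine sum_congr rfl fun j _ => ?_
        have filter_eq : {i ∈ range n | j < part p i} = range (part (transpose p) j) := by
          ext i
          rw [mem_filter, mem_range, mem_range, lt_part_transpose_iff]
          exact and_iff_right_of_imp fun hi => lt_of_part_ne_zero (Nat.zero_le j |>.trans_lt hi).ne'
        rw [filter_eq, card_range]
    _ = ∑ i ∈ range n, #{j ∈ range k | j < part p i} := by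
        simp only [card_filter]
        exact sum_comm
    _ = ∑ i ∈ range n, min k (part p i) := by
        refine sum_congr rfl fun i _ => ?_
        have filter_eq : {j ∈ range k | j < part p i} = range (min k (part p i)) := by
          ext j
          simp only [mem_filter, mem_range, lt_min_iff]
        rw [filter_eq, card_range]

theorem rowSum_transpose_add_sum_sub (p : n.Partition) (k : ℕ) :
    rowSum (transpose p) k + ∑ i ∈ range n, (part p i - k) = n := by
  rw [rowSum_transpose, ← sum_add_distrib]
  conv_rhs => rw [← rowSum_of_le p le_rfl, rowSum_eq_sum_part]
  exact sum_congr rfl fun i _ => by omega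

theorem sum_part_le_mul_add_sum_sub (p : n.Partition) (t : Finset ℕ) (k : ℕ) :
    ∑ i ∈ t, part p i ≤ #t * k + ∑ i ∈ range n, (part p i - k) :=
  calc ∑ i ∈ t, part p i
      ≤ ∑ i ∈ t, (k + (part p i - k)) := sum_le_sum fun i _ => by omega
    _ = #t * k + ∑ i ∈ t, (part p i - k) := by rw [sum_add_distrib, sum_const, smul_eq_mul]
    _ ≤ #t * k + ∑ i ∈ range n, (part p i - k) :=
        Nat.add_le_add_left (sum_le_sum_of_ne_zero fun i _ hi =>
          mem_range.2 (lt_of_part_ne_zero fun h => hi (by rw [h, Nat.zero_sub]))) _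

theorem mul_add_sum_sub_le_rowSum (p : n.Partition) {j k : ℕ} (hlt : ∀ i < j, k ≤ part p i)
    (hge : ∀ i, j ≤ i → part p i ≤ k) : j * k + ∑ i ∈ range n, (part p i - k) ≤ rowSum p j :=
  calc j * k + ∑ i ∈ range n, (part p i - k)
      ≤ j * k + ∑ i ∈ range j, (part p i - k) :=
        Nat.add_le_add_left (sum_le_sum_of_ne_zero fun i _ hi =>
          mem_range.2 (not_le.1 fun h => hi (Nat.sub_eq_zero_of_le (hge i h)))) _
    _ = ∑ i ∈ range j, (k + (part p i - k)) := by simp only [sum_add_distrib, sum_const,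
          card_range, smul_eq_mul]
    _ = rowSum p j := by
        rw [rowSum_eq_sum_part]
        exact sum_congr rfl fun i hi => Nat.add_sub_cancel' (hlt i (mem_range.1 hi))

theorem sum_part_le_rowSum (p : n.Partition) (t : Finset ℕ) :
    ∑ i ∈ t, part p i ≤ rowSum p #t :=
  (sum_part_le_mul_add_sum_sub p t (part p #t)).trans
    (mul_add_sum_sub_le_rowSum p (fun _ hi => part_antitone p hi.le) fun _ hi => part_antitone p hi)

theorem transpose_antitone : Antitone (transpose : n.Partition → n.Partition) := by
  intro p q hpq k
  have p_eq := rowSum_transpose_add_sum_sub p k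
  have q_eq := rowSum_transpose_add_sum_sub q k
  set j := part (transpose p) k
  have excess_p := mul_add_sum_sub_le_rowSum p (j := j) (k := k)
    (fun i hi => ((lt_part_transpose_iff p i k).1 hi).le)
    (fun i hi => not_lt.1 fun h => hi.not_gt ((lt_part_transpose_iff p i k).2 h))
  have excess_q := sum_part_le_mul_add_sum_sub q (range j) k
  rw [card_range, ← rowSum_eq_sum_part] at excess_q
  have : rowSum p j ≤ rowSum q j := hpq j
  omega

end Partitions

/-! ### Functions with prescribed fibre sizes -/

section Shape

variable {n : ℕ} {ι : Type*} [Fintype ι]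

/-- The fibre of `s` over `r` has as many elements as the `r`-th part of `p`, for every `r`; such
an `s` is a set partition of `ι` of type `p`, with its blocks numbered by decreasing size. -/
def HasShape (p : n.Partition) (s : ι → ℕ) : Prop :=
  ∀ r, #{i | s i = r} = part p r

namespace HasShape

variable {p : n.Partition} {s u : ι → ℕ}

theorem card_mem (hs : HasShape p s) (t : Finset ℕ) : #{i | s i ∈ t} = ∑ r ∈ t, part p r := by
  have maps_to : Set.MapsTo s (({i | s i ∈ t} : Finset ι) : Set ι) t := fun i hi =>
    (mem_filter.1 hi).2
  rw [card_eq_sum_card_fiberwise maps_to]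
  refine sum_congr rfl fun r hr => ?_
  rw [← hs r, filter_filter]
  exact congrArg card (filter_congr fun i _ => and_iff_right_of_imp fun h => h ▸ hr)

theorem card_lt (hs : HasShape p s) (k : ℕ) : #{i | s i < k} = rowSum p k := by
  simpa only [mem_range, ← rowSum_eq_sum_part] using hs.card_mem (range k)

theorem exists_perm (hs : HasShape p s) (hu : HasShape p u) :
    ∃ e : Equiv.Perm ι, ∀ i, u (e i) = s i := by
  have fibres_equiv (r : ℕ) : Nonempty ({i // s i = r} ≃ {i // u i = r}) := by
    rw [← Fintype.card_eq, Fintype.card_subtype, Fintype.card_subtype, hs r, hu r]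
  exact ⟨Equiv.ofFiberEquiv fun r => (fibres_equiv r).some, fun i => Equiv.ofFiberEquiv_map _ i⟩

end HasShape

theorem exists_hasShape {α : Type*} [Finite α] (hι : Fintype.card ι = n) (f : ι → α) :
    ∃ (p : n.Partition) (e : α ↪ ℕ), HasShape p (e ∘ f) := by
  have := Fintype.ofFinite α
  let E : α ≃ Fin (Fintype.card α) := Fintype.equivFin α
  let size (c : Fin (Fintype.card α)) : ℕ := #{i | E (f i) = c}
  let e : Equiv.Perm (Fin (Fintype.card α)) := Tuple.sort fun c => OrderDual.toDual (size c)
  have antitone_size : Antitone (size ∘ e) := fun a b hab =>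
    Tuple.monotone_sort (fun c => OrderDual.toDual (size c)) hab
  have sorted : (List.ofFn (size ∘ e)).Pairwise (· ≥ ·) :=
    List.pairwise_ofFn.2 fun _ _ hab => antitone_size hab.le
  have sum_size : (List.ofFn (size ∘ e) : Multiset ℕ).sum = n := by
    rw [Multiset.sum_coe, List.sum_ofFn, ← hι]
    exact (Equiv.sum_comp e size).trans
      (card_eq_sum_card_fiberwise (s := univ) fun _ _ => mem_univ _).symm
  refine ⟨Nat.Partition.ofSums _ _ sum_size, (E.trans e.symm).toEmbedding.trans Fin.valEmbedding,
    fun r => ?_⟩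
  rw [part_ofSums sorted]
  by_cases hr : r < Fintype.card α
  · rw [List.getD_eq_getElem _ _ (by simpa using hr), List.getElem_ofFn]
    refine congrArg card (filter_congr fun i _ => ?_)
    change ((e.symm (E (f i)) : ℕ) = r) ↔ E (f i) = e ⟨r, hr⟩
    rw [← Fin.ext_iff (b := ⟨r, hr⟩), Equiv.symm_apply_eq]
  · rw [List.getD_eq_default _ _ (by simpa using hr), card_eq_zero, filter_eq_empty_iff]
    exact fun i _ h => hr (h ▸ (e.symm (E (f i))).isLt)

end Shape

/-! ### The blocks of a Young subgroup -/

section Blocks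

variable {n : ℕ} (p : n.Partition)

theorem exists_lt_rowSum (i : Fin n) : ∃ r, (i : ℕ) < rowSum p (r + 1) :=
  ⟨n, i.isLt.trans_eq (rowSum_of_le p n.le_succ).symm⟩

/-- The index of the block of `p` that contains `i`. -/
def blockIndex (i : Fin n) : ℕ := Nat.find (exists_lt_rowSum p i)

theorem mem_block_iff (i : Fin n) (r : ℕ) : i ∈ block p r ↔ blockIndex p i = r := by
  rw [blockIndex, Nat.find_eq_iff]
  refine ⟨fun ⟨hle, hlt⟩ => ⟨hlt, fun m hm => not_lt.2 ((rowSum_mono p hm).trans hle)⟩,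
    fun ⟨hlt, hmin⟩ => ⟨?_, hlt⟩⟩
  cases r with
  | zero => exact Nat.zero_le _
  | succ r => exact not_lt.1 (hmin r r.lt_succ_self)

theorem mem_youngSubgroup_iff (σ : Equiv.Perm (Fin n)) :
    σ ∈ youngSubgroup p ↔ ∀ i, blockIndex p (σ i) = blockIndex p i := by
  change (∀ r i, σ i ∈ block p r ↔ i ∈ block p r) ↔ _
  simp only [mem_block_iff]
  exact ⟨fun h i => (h _ i).2 rfl, fun h r i => by rw [h i]⟩

theorem hasShape_blockIndex : HasShape p (blockIndex p) := by
  intro r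
  have image_eq : ({i | blockIndex p i = r} : Finset (Fin n)).map Fin.valEmbedding =
      Ico (rowSum p r) (rowSum p (r + 1)) := by
    ext m
    simp only [mem_map, mem_filter, mem_univ, true_and, Fin.valEmbedding_apply, mem_Ico,
      ← mem_block_iff]
    exact ⟨fun ⟨_, hi, him⟩ => him ▸ hi, fun hm => ⟨⟨m, hm.2.trans_le (rowSum_le p _)⟩, hm, rfl⟩⟩
  rw [← card_map, image_eq, Nat.card_Ico, rowSum_eq_sum_part, rowSum_eq_sum_part,
    sum_range_succ, Nat.add_sub_cancel_left]

end Blocks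

/-! ### Semistandard tableaux and Schensted insertion -/

theorem eq_nil_of_sum_length_eq_zero {α : Type*} {T : List (List α)} (h : [] ∉ T)
    (hsum : (T.map List.length).sum = 0) : T = [] := by
  cases T with
  | nil => rfl
  | cons r rs =>
    have : r.length = 0 := by
      rw [List.map_cons, List.sum_cons] at hsum
      omega
    exact absurd (List.eq_nil_of_length_eq_zero this ▸ List.mem_cons_self) h

section Insertion

variable {α : Type*} [LinearOrder α] {a x y : α} {r s t : List α} {rs T : List (List α)}

/-- `Below r s`: the row `s` may stand directly below the row `r` in a tableau, that is, it is not
longer than `r` and each of its entries exceeds the entry of `r` above it. -/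
inductive Below : List α → List α → Prop
  | nil (r : List α) : Below r []
  | cons {a b : α} {r s : List α} (hab : a < b) (hrs : Below r s) : Below (a :: r) (b :: s)

/-- The rows `T`, listed from top to bottom, form a semistandard tableau; `T` may end with empty
rows. -/
def IsTableau (T : List (List α)) : Prop :=
  (∀ r ∈ T, r.Pairwise (· ≤ ·)) ∧ T.IsChain Below

theorem Below.exists_getElem?_lt (h : Below r s) {j : ℕ} {b : α} (hb : s[j]? = some b) :
    ∃ a, r[j]? = some a ∧ a < b := by
  induction h generalizing j with
  | nil r => simp at hb
  | @cons a c r s hac _ ih =>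
    cases j with
    | zero =>
      obtain rfl : c = b := by simpa using hb
      exact ⟨a, rfl, hac⟩
    | succ j => simpa using ih (by simpa using hb)

theorem Below.length_le (h : Below r s) : s.length ≤ r.length := by
  induction h with
  | nil r => simp
  | cons _ _ ih => simpa using ih

theorem Below.trans (hrs : Below r s) (hst : Below s t) : Below r t := by
  induction hst generalizing r with
  | nil s => exact .nil r
  | cons hbc _ ih =>
    cases hrs with
    | cons hab hrs => exact .cons (hab.trans hbc) (ih hrs)

theorem rowInsert_cons_of_lt (h : x < a) (r : List α) : rowInsert x (a :: r) = (x :: r, some a) :=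
  if_pos h

theorem rowInsert_cons_of_le (h : a ≤ x) (r : List α) :
    rowInsert x (a :: r) = (a :: (rowInsert x r).1, (rowInsert x r).2) :=
  if_neg h.not_gt

theorem lt_of_rowInsert_eq_some (h : (rowInsert x r).2 = some y) : x < y := by
  induction r with
  | nil => cases h
  | cons a r ih =>
    rcases lt_or_ge x a with hx | hx
    · rw [rowInsert_cons_of_lt hx] at h
      exact Option.some.inj h ▸ hx
    · rw [rowInsert_cons_of_le hx] at h
      exact ih h

theorem mem_rowInsert_self (x : α) (r : List α) : x ∈ (rowInsert x r).1 := by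
  induction r with
  | nil => exact List.mem_singleton_self x
  | cons a r ih =>
    rcases lt_or_ge x a with hx | hx
    · simp [rowInsert_cons_of_lt hx]
    · simp [rowInsert_cons_of_le hx, ih]

theorem rowInsert_perm (x : α) (r : List α) :
    ((rowInsert x r).2.toList ++ (rowInsert x r).1).Perm (x :: r) := by
  induction r with
  | nil => rfl
  | cons a r ih =>
    rcases lt_or_ge x a with hx | hx
    · rw [rowInsert_cons_of_lt hx]
      exact List.Perm.swap _ _ _
    · rw [rowInsert_cons_of_le hx]
      exact List.perm_middle.trans ((ih.cons a).trans (List.Perm.swap _ _ _))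

theorem rowInsert_pairwise (h : r.Pairwise (· ≤ ·)) : (rowInsert x r).1.Pairwise (· ≤ ·) := by
  induction r with
  | nil => exact List.pairwise_singleton _ x
  | cons a r ih =>
    obtain ⟨head_le, tail_sorted⟩ := List.pairwise_cons.1 h
    rcases lt_or_ge x a with hx | hx
    · rw [rowInsert_cons_of_lt hx]
      exact List.pairwise_cons.2 ⟨fun z hz => hx.le.trans (head_le z hz), tail_sorted⟩
    · rw [rowInsert_cons_of_le hx]
      refine List.pairwise_cons.2 ⟨fun z hz => ?_, ih tail_sorted⟩
      rcases List.mem_cons.1 ((rowInsert_perm x r).mem_iff.1 (List.mem_append_right _ hz)) with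
        rfl | hz
      · exact hx
      · exact head_le z hz

theorem Below.rowInsert_left (h : Below r s) (x : α) : Below (rowInsert x r).1 s := by
  induction h with
  | nil r => exact .nil _
  | @cons a b r s hab hrs ih =>
    rcases lt_or_ge x a with hx | hx
    · rw [rowInsert_cons_of_lt hx]
      exact .cons (hx.trans hab) hrs
    · rw [rowInsert_cons_of_le hx]
      exact .cons hab ih

theorem Below.rowInsert_bumped (h : Below r s) (hy : (rowInsert x r).2 = some y) :
    Below (rowInsert x r).1 (rowInsert y s).1 := by
  induction r generalizing s with
  | nil => cases hy
  | cons a r ih =>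
    rcases lt_or_ge x a with hx | hx
    · rw [rowInsert_cons_of_lt hx] at hy ⊢
      obtain rfl : a = y := Option.some.inj hy
      cases h with
      | nil => exact .cons hx (.nil r)
      | cons hab hrs =>
        rw [rowInsert_cons_of_lt hab]
        exact .cons hx hrs
    · rw [rowInsert_cons_of_le hx] at hy ⊢
      have hay : a < y := hx.trans_lt (lt_of_rowInsert_eq_some hy)
      cases h with
      | nil => exact .cons hay (.nil _)
      | @cons _ b _ s hab hrs =>
        rcases lt_or_ge y b with hyb | hyb
        · rw [rowInsert_cons_of_lt hyb]
          exact .cons hay (hrs.rowInsert_left x)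
        · rw [rowInsert_cons_of_le hyb]
          exact .cons hab (ih hrs hy)

theorem tableauInsert_cons_of_eq_none (rs : List (List α)) (h : (rowInsert x r).2 = none) :
    tableauInsert x (r :: rs) = (rowInsert x r).1 :: rs := by
  rw [tableauInsert, ← Prod.mk.eta (p := rowInsert x r), h]

theorem tableauInsert_cons_of_eq_some (rs : List (List α)) (h : (rowInsert x r).2 = some y) :
    tableauInsert x (r :: rs) = (rowInsert x r).1 :: tableauInsert y rs := by
  rw [tableauInsert, ← Prod.mk.eta (p := rowInsert x r), h]

theorem isTableau_cons :
    IsTableau (r :: T) ↔ r.Pairwise (· ≤ ·) ∧ (∀ s ∈ T.head?, Below r s) ∧ IsTableau T := by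
  simp only [IsTableau, List.isChain_cons, List.mem_cons, forall_eq_or_imp]
  tauto

theorem head?_tableauInsert (x : α) (T : List (List α)) :
    (tableauInsert x T).head? = some (rowInsert x (T.headD [])).1 := by
  cases T with
  | nil => rfl
  | cons r rs =>
    rcases hy : (rowInsert x r).2 with _ | y
    · rw [tableauInsert_cons_of_eq_none rs hy]; rfl
    · rw [tableauInsert_cons_of_eq_some rs hy]; rfl

theorem IsTableau.tableauInsert (h : IsTableau T) (x : α) : IsTableau (tableauInsert x T) := by
  induction T generalizing x with
  | nil => simp [YoungPerm.tableauInsert, IsTableau]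
  | cons r rs ih =>
    obtain ⟨row_sorted, head_below, tail_isTableau⟩ := isTableau_cons.1 h
    rcases hy : (rowInsert x r).2 with _ | y
    · rw [tableauInsert_cons_of_eq_none rs hy, isTableau_cons]
      exact ⟨rowInsert_pairwise row_sorted, fun s hs => (head_below s hs).rowInsert_left x,
        tail_isTableau⟩
    · have headD_below : Below r (rs.headD []) := by
        cases rs with
        | nil => exact .nil r
        | cons s rs => exact head_below s rfl
      rw [tableauInsert_cons_of_eq_some rs hy, isTableau_cons, head?_tableauInsert]
      exact ⟨rowInsert_pairwise row_sorted,
        fun s hs => Option.some.inj hs ▸ headD_below.rowInsert_bumped hy, ih tail_isTableau y⟩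

theorem insertionTableau_concat (w : List α) (x : α) :
    insertionTableau (w ++ [x]) = tableauInsert x (insertionTableau w) :=
  List.foldl_concat ..

theorem isTableau_insertionTableau (w : List α) : IsTableau (insertionTableau w) := by
  induction w using List.reverseRecOn with
  | nil => simp [insertionTableau, IsTableau]
  | append_singleton w x ih => exact insertionTableau_concat w x ▸ ih.tableauInsert x

theorem flatten_tableauInsert_perm (T : List (List α)) (x : α) :
    (tableauInsert x T).flatten.Perm (x :: T.flatten) := by
  induction T generalizing x with
  | nil => rfl
  | cons r rs ih =>
    have row_perm := (rowInsert_perm x r).append_right rs.flatten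
    rcases hy : (rowInsert x r).2 with _ | y <;> rw [hy] at row_perm
    · rw [tableauInsert_cons_of_eq_none rs hy]
      exact row_perm
    · rw [tableauInsert_cons_of_eq_some rs hy]
      exact ((ih y).append_left _).trans (List.perm_middle.trans row_perm)

theorem flatten_insertionTableau_perm (w : List α) : (insertionTableau w).flatten.Perm w := by
  induction w using List.reverseRecOn with
  | nil => rfl
  | append_singleton w x ih =>
    rw [insertionTableau_concat]
    exact (flatten_tableauInsert_perm _ x).trans
      ((ih.cons x).trans (List.perm_append_singleton x w).symm)

/-- The index of the row that grows when `x` is inserted into `T`. -/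
def insertRow (x : α) : List (List α) → ℕ
  | [] => 0
  | r :: rs =>
    match (rowInsert x r).2 with
    | none => 0
    | some y => insertRow y rs + 1

theorem insertRow_cons_of_eq_none (rs : List (List α)) (h : (rowInsert x r).2 = none) :
    insertRow x (r :: rs) = 0 := by
  rw [insertRow, h]

theorem insertRow_cons_of_eq_some (rs : List (List α)) (h : (rowInsert x r).2 = some y) :
    insertRow x (r :: rs) = insertRow y rs + 1 := by
  rw [insertRow, h]

theorem length_getD_tableauInsert (T : List (List α)) (x : α) (i : ℕ) :
    ((tableauInsert x T).getD i []).length =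
      (T.getD i []).length + if i = insertRow x T then 1 else 0 := by
  induction T generalizing x i with
  | nil => cases i <;> simp [tableauInsert, insertRow]
  | cons r rs ih =>
    have row_length := rowInsert_length x r
    rcases hy : (rowInsert x r).2 with _ | y <;> rw [hy] at row_length
    · rw [tableauInsert_cons_of_eq_none rs hy, insertRow_cons_of_eq_none rs hy]
      cases i with
      | zero => simpa using row_length
      | succ i => simp
    · rw [tableauInsert_cons_of_eq_some rs hy, insertRow_cons_of_eq_some rs hy]
      cases i with
      | zero => simpa using row_length
      | succ i => simpa using ih y i

theorem rowInsert_cons_ne_of_lt_of_le {a' x' : α} {r' : List α} (hr : (a :: r).Pairwise (· ≤ ·))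
    (hx : x < a) (hx' : a' ≤ x') : rowInsert x (a :: r) ≠ rowInsert x' (a' :: r') := by
  rw [rowInsert_cons_of_lt hx, rowInsert_cons_of_le hx']
  intro h
  simp only [Prod.mk.injEq, List.cons.injEq] at h
  have bumped_gt : x' < a := lt_of_rowInsert_eq_some h.2.symm
  have inserted_mem : x' ∈ r := h.1.2 ▸ mem_rowInsert_self x' r'
  exact bumped_gt.not_ge ((List.pairwise_cons.1 hr).1 x' inserted_mem)

theorem rowInsert_injective {x' : α} {r' : List α} (hr : r.Pairwise (· ≤ ·))
    (hr' : r'.Pairwise (· ≤ ·)) (h : rowInsert x r = rowInsert x' r') : x = x' ∧ r = r' := by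
  have length_eq : r.length = r'.length := by
    have length_x := rowInsert_length x r
    have length_x' := rowInsert_length x' r'
    rw [h] at length_x
    omega
  induction r generalizing r' with
  | nil =>
    obtain rfl := List.eq_nil_of_length_eq_zero length_eq.symm
    simpa [rowInsert] using h
  | cons a r ih =>
    obtain ⟨a', r', rfl⟩ := List.exists_cons_of_length_eq_add_one length_eq.symm
    rcases lt_or_ge x a with hx | hx <;> rcases lt_or_ge x' a' with hx' | hx'
    · rw [rowInsert_cons_of_lt hx, rowInsert_cons_of_lt hx'] at h
      simp only [Prod.mk.injEq, List.cons.injEq, Option.some.injEq] at h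
      exact ⟨h.1.1, by rw [h.1.2, h.2]⟩
    · exact absurd h (rowInsert_cons_ne_of_lt_of_le hr hx hx')
    · exact absurd h.symm (rowInsert_cons_ne_of_lt_of_le hr' hx' hx)
    · rw [rowInsert_cons_of_le hx, rowInsert_cons_of_le hx'] at h
      simp only [Prod.mk.injEq, List.cons.injEq] at h
      obtain ⟨x_eq, r_eq⟩ :=
        ih hr.of_cons hr'.of_cons (Prod.ext h.1.2 h.2) (Nat.succ.inj length_eq)
      exact ⟨x_eq, by rw [h.1.1, r_eq]⟩

theorem nil_notMem_tableauInsert (h : [] ∉ T) (x : α) : [] ∉ tableauInsert x T := by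
  have row_ne_nil (x : α) (r : List α) : [] ≠ (rowInsert x r).1 :=
    (List.ne_nil_of_mem (mem_rowInsert_self x r)).symm
  induction T generalizing x with
  | nil => simp [tableauInsert]
  | cons r rs ih =>
    have tail_notMem : [] ∉ rs := fun hrs => h (List.mem_cons_of_mem r hrs)
    rcases hy : (rowInsert x r).2 with _ | y
    · rw [tableauInsert_cons_of_eq_none rs hy]
      exact List.not_mem_cons_of_ne_of_not_mem (row_ne_nil x r) tail_notMem
    · rw [tableauInsert_cons_of_eq_some rs hy]
      exact List.not_mem_cons_of_ne_of_not_mem (row_ne_nil x r) (ih tail_notMem y)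

theorem nil_notMem_insertionTableau (w : List α) : [] ∉ insertionTableau w := by
  induction w using List.reverseRecOn with
  | nil => simp [insertionTableau]
  | append_singleton w x ih => exact insertionTableau_concat w x ▸ nil_notMem_tableauInsert ih x

theorem tableauInsert_injective {T' : List (List α)} {x' : α} (hT : IsTableau T)
    (hT' : IsTableau T') (hne : [] ∉ T) (hne' : [] ∉ T')
    (h : tableauInsert x T = tableauInsert x' T') (hrow : insertRow x T = insertRow x' T') :
    x = x' ∧ T = T' := by
  have size_eq : (T.map List.length).sum = (T'.map List.length).sum := by
    have size_x := tableauInsert_size T x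
    rwa [h, tableauInsert_size, Nat.add_right_cancel_iff, eq_comm] at size_x
  induction T generalizing T' x x' with
  | nil =>
    obtain rfl := eq_nil_of_sum_length_eq_zero hne' size_eq.symm
    simpa [tableauInsert] using h
  | cons r rs ih =>
    cases T' with
    | nil => exact absurd (eq_nil_of_sum_length_eq_zero hne size_eq) (List.cons_ne_nil r rs)
    | cons r' rs' =>
      obtain ⟨hr, -, hrs⟩ := isTableau_cons.1 hT
      obtain ⟨hr', -, hrs'⟩ := isTableau_cons.1 hT'
      rcases hy : (rowInsert x r).2 with _ | y <;> rcases hy' : (rowInsert x' r').2 with _ | y'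
      · rw [tableauInsert_cons_of_eq_none _ hy, tableauInsert_cons_of_eq_none _ hy'] at h
        obtain ⟨row_eq, rfl⟩ := List.cons.inj h
        obtain ⟨x_eq, rfl⟩ := rowInsert_injective hr hr' (Prod.ext row_eq (hy.trans hy'.symm))
        exact ⟨x_eq, rfl⟩
      · simp [insertRow_cons_of_eq_none _ hy, insertRow_cons_of_eq_some _ hy'] at hrow
      · simp [insertRow_cons_of_eq_some _ hy, insertRow_cons_of_eq_none _ hy'] at hrow
      · rw [insertRow_cons_of_eq_some _ hy, insertRow_cons_of_eq_some _ hy'] at hrow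
        rw [tableauInsert_cons_of_eq_some _ hy, tableauInsert_cons_of_eq_some _ hy'] at h
        obtain ⟨row_eq, tail_eq⟩ := List.cons.inj h
        have tail_size := tableauInsert_size rs y
        rw [tail_eq, tableauInsert_size, Nat.add_right_cancel_iff, eq_comm] at tail_size
        obtain ⟨rfl, rfl⟩ := ih hrs hrs' (fun hm => hne (List.mem_cons_of_mem r hm))
          (fun hm => hne' (List.mem_cons_of_mem r' hm)) tail_eq (Nat.succ.inj hrow) tail_size
        obtain ⟨x_eq, rfl⟩ := rowInsert_injective hr hr' (Prod.ext row_eq (hy.trans hy'.symm))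
        exact ⟨x_eq, rfl⟩

end Insertion

/-! ### The insertion and recording tableaux of a permutation -/

section Boxes

variable {α : Type*} {T : List (List α)}

theorem mem_flatten_of_mem_getD {a : α} {r : ℕ} (h : a ∈ T.getD r []) : a ∈ T.flatten := by
  by_cases hr : r < T.length
  · rw [List.getD_eq_getElem _ _ hr] at h
    exact List.mem_flatten.2 ⟨_, List.getElem_mem hr, h⟩
  · rw [List.getD_eq_default _ _ (not_lt.1 hr)] at h
    exact absurd h List.not_mem_nil

theorem nodup_getD (hT : T.flatten.Nodup) (r : ℕ) : (T.getD r []).Nodup := by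
  by_cases hr : r < T.length
  · rw [List.getD_eq_getElem _ _ hr]
    exact (List.nodup_flatten.1 hT).1 _ (List.getElem_mem hr)
  · rw [List.getD_eq_default _ _ (not_lt.1 hr)]
    exact List.nodup_nil

theorem lt_length_iff_getD_ne_nil (h : [] ∉ T) (r : ℕ) : r < T.length ↔ T.getD r [] ≠ [] := by
  by_cases hr : r < T.length
  · rw [List.getD_eq_getElem _ _ hr]
    exact iff_of_true hr fun e => h (e ▸ List.getElem_mem hr)
  · simp [hr]

theorem eq_of_forall_getD_eq {T' : List (List α)} (h : [] ∉ T) (h' : [] ∉ T')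
    (hrow : ∀ r, T.getD r [] = T'.getD r []) : T = T' := by
  have length_eq : T.length = T'.length := eq_of_forall_lt_iff fun r => by
    rw [lt_length_iff_getD_ne_nil h, lt_length_iff_getD_ne_nil h', hrow]
  refine List.ext_getElem length_eq fun r hr hr' => ?_
  rw [← List.getD_eq_getElem _ [] hr, ← List.getD_eq_getElem _ [] hr', hrow]

/-- The box (row, column) of the first occurrence of `a` in `T`, both coordinates starting at `0`;
a meaningless box below `T` if `a` does not occur. -/
def boxOf [DecidableEq α] (a : α) : List (List α) → ℕ × ℕ
  | [] => (0, 0)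
  | r :: rs => if a ∈ r then (0, r.idxOf a) else ((boxOf a rs).1 + 1, (boxOf a rs).2)

theorem boxOf_eq_iff [DecidableEq α] (hT : T.flatten.Nodup) {a : α} (ha : a ∈ T.flatten)
    (r c : ℕ) : boxOf a T = (r, c) ↔ (T.getD r [])[c]? = some a := by
  induction T generalizing r with
  | nil => exact absurd ha List.not_mem_nil
  | cons s T ih =>
    obtain ⟨nodup_s, nodup_T, disjoint⟩ := List.nodup_append'.1 hT
    by_cases has : a ∈ s
    · rw [boxOf, if_pos has]
      cases r with
      | zero =>
        rw [List.getD_cons_zero, Prod.mk.injEq, eq_self, true_and]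
        refine ⟨fun h => h ▸ List.getElem?_idxOf has, fun h => ?_⟩
        obtain ⟨hc, rfl⟩ := List.getElem?_eq_some_iff.1 h
        exact nodup_s.idxOf_getElem c hc
      | succ r =>
        refine iff_of_false (by simp) fun h => disjoint has ?_
        exact mem_flatten_of_mem_getD (List.mem_of_getElem? (List.getD_cons_succ .. ▸ h))
    · have haT : a ∈ T.flatten := (List.mem_append.1 ha).resolve_left has
      rw [boxOf, if_neg has]
      cases r with
      | zero =>
        refine iff_of_false (by simp) fun h => has ?_
        exact List.mem_of_getElem? (List.getD_cons_zero .. ▸ h)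
      | succ r => rw [List.getD_cons_succ, ← ih nodup_T haT, Prod.ext_iff, Prod.ext_iff,
          Nat.add_right_cancel_iff]

variable [LinearOrder α]

namespace IsTableau

theorem below_getD (hT : IsTableau T) (r : ℕ) : Below (T.getD r []) (T.getD (r + 1) []) := by
  by_cases hr : r + 1 < T.length
  · rw [List.getD_eq_getElem _ _ hr, List.getD_eq_getElem _ _ (Nat.lt_of_succ_lt hr)]
    exact List.isChain_iff_getElem.1 hT.2 r hr
  · rw [List.getD_eq_default _ _ (not_lt.1 hr)]
    exact .nil _

theorem pairwise_getD (hT : IsTableau T) (r : ℕ) : (T.getD r []).Pairwise (· ≤ ·) := by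
  by_cases hr : r < T.length
  · rw [List.getD_eq_getElem _ _ hr]
    exact hT.1 _ (List.getElem_mem hr)
  · rw [List.getD_eq_default _ _ (not_lt.1 hr)]
    exact List.Pairwise.nil

theorem pairwise_map_length (hT : IsTableau T) : (T.map List.length).Pairwise (· ≥ ·) := by
  have : Trans (Below (α := α)) Below Below := ⟨Below.trans⟩
  exact List.pairwise_map.2 ((List.isChain_iff_pairwise.1 hT.2).imp Below.length_le)

theorem eq_of_forall_mem_getD_iff {T' : List (List α)} (hT : IsTableau T) (hT' : IsTableau T')
    (hnodup : T.flatten.Nodup) (hnodup' : T'.flatten.Nodup) (hne : [] ∉ T) (hne' : [] ∉ T')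
    (h : ∀ r a, a ∈ T.getD r [] ↔ a ∈ T'.getD r []) : T = T' :=
  eq_of_forall_getD_eq hne hne' fun r =>
    have perm : (T.getD r []).Perm (T'.getD r []) :=
      (List.perm_ext_iff_of_nodup (nodup_getD hnodup r) (nodup_getD hnodup' r)).2 (h r)
    perm.eq_of_pairwise (fun _ _ _ _ => le_antisymm) (hT.pairwise_getD r) (hT'.pairwise_getD r)

end IsTableau

end Boxes

section Fillings

variable {n : ℕ}

/-- `box i` is the box (row, column) of the diagram of `p` that holds `i`: every box is used exactly
once, and the entries increase down the columns. -/
structure IsColumnStandard {ι : Type*} [LT ι] (p : n.Partition) (box : ι → ℕ × ℕ) : Prop where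
  injective : Function.Injective box
  exists_eq_iff (r c : ℕ) : (∃ i, box i = (r, c)) ↔ c < part p r
  exists_above (i : ι) (r c : ℕ) : box i = (r + 1, c) → ∃ j < i, box j = (r, c)

theorem card_fst_eq {ι : Type*} [Fintype ι] {box : ι → ℕ × ℕ} (hinj : Function.Injective box)
    {len : ℕ → ℕ} (hlen : ∀ r c, (∃ i, box i = (r, c)) ↔ c < len r) (r : ℕ) :
    #{i | (box i).1 = r} = len r := by
  rw [← card_range (len r)]
  refine card_bij (fun i _ => (box i).2) (fun i hi => ?_) (fun i hi j hj hij => ?_) fun c hc => ?_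
  · exact mem_range.2 ((hlen r _).1 ⟨i, Prod.ext (mem_filter.1 hi).2 rfl⟩)
  · exact hinj (Prod.ext ((mem_filter.1 hi).2.trans (mem_filter.1 hj).2.symm) hij)
  · obtain ⟨i, hi⟩ := (hlen r c).2 (mem_range.1 hc)
    exact ⟨i, by simp [hi], by simp [hi]⟩

namespace IsColumnStandard

variable {ι : Type*} [Fintype ι] [LT ι] {p : n.Partition} {box : ι → ℕ × ℕ}

theorem hasShape_fst (h : IsColumnStandard p box) : HasShape p fun i => (box i).1 :=
  card_fst_eq h.injective h.exists_eq_iff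

theorem hasShape_snd (h : IsColumnStandard p box) :
    HasShape (transpose p) fun i => (box i).2 :=
  card_fst_eq (Prod.swap_injective.comp h.injective) fun c r => by
    rw [lt_part_transpose_iff, ← h.exists_eq_iff]
    simp only [Function.comp_apply, Prod.swap_eq_iff_eq_swap, Prod.swap_prod_mk]

end IsColumnStandard

/-- The word `σ(1) σ(2) … σ(n)`. -/
def permWord (σ : Equiv.Perm (Fin n)) : List (Fin n) := List.ofFn fun i => σ i

theorem nodup_flatten_insertionTableau_permWord (σ : Equiv.Perm (Fin n)) :
    (insertionTableau (permWord σ)).flatten.Nodup :=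
  (flatten_insertionTableau_perm _).nodup_iff.2 (List.nodup_ofFn.2 σ.injective)

theorem part_rsShape (σ : Equiv.Perm (Fin n)) (r : ℕ) :
    part (rsShape σ) r = ((insertionTableau (permWord σ)).getD r []).length :=
  (part_ofSums (isTableau_insertionTableau _).pairwise_map_length _ r).trans
    (List.getD_map (d := ([] : List (Fin n))) ..)

/-- The box of `a` in the insertion tableau of `σ`. -/
def insertionFilling (σ : Equiv.Perm (Fin n)) (a : Fin n) : ℕ × ℕ :=
  boxOf a (insertionTableau (permWord σ))

theorem insertionFilling_eq_iff (σ : Equiv.Perm (Fin n)) (a : Fin n) (r c : ℕ) :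
    insertionFilling σ a = (r, c) ↔ ((insertionTableau (permWord σ)).getD r [])[c]? = some a :=
  boxOf_eq_iff (nodup_flatten_insertionTableau_permWord σ)
    ((flatten_insertionTableau_perm _).mem_iff.2
      (List.mem_ofFn.2 ⟨σ.symm a, σ.apply_symm_apply a⟩)) r c

theorem isColumnStandard_insertionFilling (σ : Equiv.Perm (Fin n)) :
    IsColumnStandard (rsShape σ) (insertionFilling σ) where
  injective a b hab := Option.some.inj <|
    ((insertionFilling_eq_iff σ a _ _).1 rfl).symm.trans
      ((insertionFilling_eq_iff σ b _ _).1 hab.symm)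
  exists_eq_iff r c := by
    simp only [part_rsShape, insertionFilling_eq_iff, List.getElem?_eq_some_iff]
    exact ⟨fun ⟨_, hc, _⟩ => hc, fun hc => ⟨_, hc, rfl⟩⟩
  exists_above a r c ha := by
    simp only [insertionFilling_eq_iff] at ha ⊢
    obtain ⟨b, hb, hba⟩ :=
      ((isTableau_insertionTableau (permWord σ)).below_getD r).exists_getElem?_lt ha
    exact ⟨b, hba, hb⟩

/-- The insertion tableau of the first `m` letters of the word of `σ`. -/
def prefixTableau (σ : Equiv.Perm (Fin n)) (m : ℕ) : List (List (Fin n)) :=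
  insertionTableau ((permWord σ).take m)

theorem prefixTableau_self (σ : Equiv.Perm (Fin n)) :
    prefixTableau σ n = insertionTableau (permWord σ) :=
  congrArg insertionTableau (List.take_of_length_le List.length_ofFn.le)

theorem prefixTableau_succ (σ : Equiv.Perm (Fin n)) (i : Fin n) :
    prefixTableau σ (i + 1) = tableauInsert (σ i) (prefixTableau σ i) := by
  have hi : (i : ℕ) < (permWord σ).length := i.isLt.trans_eq List.length_ofFn.symm
  rw [prefixTableau, prefixTableau, ← insertionTableau_concat, ← List.take_concat_get' _ _ hi]
  simp [permWord]

/-- The box of `i` in the recording tableau of `σ`: the box added by the `i`-th insertion. -/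
def recordingFilling (σ : Equiv.Perm (Fin n)) (i : Fin n) : ℕ × ℕ :=
  (insertRow (σ i) (prefixTableau σ i),
    ((prefixTableau σ i).getD (insertRow (σ i) (prefixTableau σ i)) []).length)

theorem recordingFilling_eq_iff (σ : Equiv.Perm (Fin n)) (i : Fin n) (r c : ℕ) :
    recordingFilling σ i = (r, c) ↔ r = insertRow (σ i) (prefixTableau σ i) ∧
      c = ((prefixTableau σ i).getD r []).length := by
  rw [recordingFilling, Prod.mk.injEq]
  constructor <;> rintro ⟨rfl, rfl⟩ <;> exact ⟨rfl, rfl⟩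

theorem exists_recordingFilling_eq_iff_of_lt (σ : Equiv.Perm (Fin n)) {m : ℕ} (hm : m ≤ n)
    (r c : ℕ) : (∃ i : Fin n, (i : ℕ) < m ∧ recordingFilling σ i = (r, c)) ↔
      c < ((prefixTableau σ m).getD r []).length := by
  induction m with
  | zero => simp [prefixTableau, insertionTableau]
  | succ m ih =>
    have split_last : (∃ i : Fin n, (i : ℕ) < m + 1 ∧ recordingFilling σ i = (r, c)) ↔
        (∃ i : Fin n, (i : ℕ) < m ∧ recordingFilling σ i = (r, c)) ∨
          recordingFilling σ ⟨m, hm⟩ = (r, c) := by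
      simp only [Nat.lt_succ_iff_lt_or_eq, or_and_right, exists_or]
      exact or_congr_right ⟨fun ⟨i, him, hi⟩ => (Fin.ext him : i = ⟨m, hm⟩) ▸ hi,
        fun h => ⟨_, rfl, h⟩⟩
    have length_succ : ((prefixTableau σ (m + 1)).getD r []).length = _ :=
      prefixTableau_succ σ ⟨m, hm⟩ ▸ length_getD_tableauInsert _ _ r
    rw [split_last, ih (Nat.le_of_succ_le hm), recordingFilling_eq_iff, length_succ]
    dsimp only
    split_ifs with hr <;> omega

theorem isColumnStandard_recordingFilling (σ : Equiv.Perm (Fin n)) :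
    IsColumnStandard (rsShape σ) (recordingFilling σ) where
  injective := Function.Injective.of_lt_imp_ne fun i j hij h => lt_irrefl _
    ((exists_recordingFilling_eq_iff_of_lt σ j.isLt.le _ _).1 ⟨i, hij, h⟩)
  exists_eq_iff r c := by
    rw [part_rsShape, ← prefixTableau_self, ← exists_recordingFilling_eq_iff_of_lt σ le_rfl]
    simp only [Fin.is_lt, true_and]
  exists_above i r c hi := by
    have lt_length := (exists_recordingFilling_eq_iff_of_lt σ (m := i + 1) i.isLt (r + 1) c).1
      ⟨i, Nat.lt_succ_self _, hi⟩
    have below := (isTableau_insertionTableau ((permWord σ).take (i + 1))).below_getD r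
    obtain ⟨j, hji, hj⟩ := (exists_recordingFilling_eq_iff_of_lt σ (m := i + 1) i.isLt r c).2
      (lt_length.trans_le below.length_le)
    refine ⟨j, (Nat.lt_succ_iff.1 hji).lt_of_ne fun e => ?_, hj⟩
    rw [Fin.ext e, hi] at hj
    simp at hj

theorem mem_getD_insertionTableau_iff (σ : Equiv.Perm (Fin n)) (r : ℕ) (a : Fin n) :
    a ∈ (insertionTableau (permWord σ)).getD r [] ↔ (insertionFilling σ a).1 = r := by
  simp only [List.mem_iff_getElem?, ← insertionFilling_eq_iff, Prod.ext_iff]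
  exact ⟨fun ⟨_, h, _⟩ => h, fun h => ⟨_, h, rfl⟩⟩

theorem eq_of_fillings_fst_eq {σ τ : Equiv.Perm (Fin n)}
    (hP : ∀ a, (insertionFilling σ a).1 = (insertionFilling τ a).1)
    (hQ : ∀ i, (recordingFilling σ i).1 = (recordingFilling τ i).1) : σ = τ := by
  have last_eq : prefixTableau σ n = prefixTableau τ n := by
    rw [prefixTableau_self, prefixTableau_self]
    exact (isTableau_insertionTableau _).eq_of_forall_mem_getD_iff (isTableau_insertionTableau _)
      (nodup_flatten_insertionTableau_permWord σ) (nodup_flatten_insertionTableau_permWord τ)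
      (nil_notMem_insertionTableau _) (nil_notMem_insertionTableau _) fun r a => by
        rw [mem_getD_insertionTableau_iff, mem_getD_insertionTableau_iff, hP]
  have eq_of_succ_eq (i : Fin n) (h : prefixTableau σ (i + 1) = prefixTableau τ (i + 1)) :
      σ i = τ i ∧ prefixTableau σ i = prefixTableau τ i :=
    tableauInsert_injective (isTableau_insertionTableau _) (isTableau_insertionTableau _)
      (nil_notMem_insertionTableau _) (nil_notMem_insertionTableau _)
      (by rwa [prefixTableau_succ, prefixTableau_succ] at h) (hQ i)
  have prefix_eq (m : ℕ) (hm : m ≤ n) : prefixTableau σ m = prefixTableau τ m := by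
    induction hm using Nat.decreasingInduction with
    | self => exact last_eq
    | of_succ m hm ih => exact (eq_of_succ_eq ⟨m, hm⟩ ih).2
  exact Equiv.ext fun i => (eq_of_succ_eq i (prefix_eq _ i.isLt)).1

end Fillings

/-! ### Disjoint decreasing subsequences -/

section Decreasing

variable {α : Type*}

/-- The row reading word of a tableau: its rows are read from bottom to top. -/
def readingWord : List (List α) → List α
  | [] => []
  | r :: rs => readingWord rs ++ r

theorem readingWord_perm (T : List (List α)) : (readingWord T).Perm T.flatten := by
  induction T with
  | nil => exact List.Perm.refl _
  | cons r rs ih => exact List.perm_append_comm.trans (ih.append_left r)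

variable [LinearOrder α]

/-- The letters of `w` of each colour `< k` form a decreasing subsequence. The remaining colours
mark the letters outside these `k` subsequences. -/
def IsDecreasingColouring (k : ℕ) (c : α → ℕ) (w : List α) : Prop :=
  w.Pairwise fun a b => c a = c b → c a < k → b < a

/-- Elementary transformations along which `k` disjoint decreasing subsequences can be transported
from the second word to the first. Besides one of the two Knuth relations this allows every swap
that creates an inversion in the first word, so the relation is not symmetric. -/
inductive ColourStep : List α → List α → Prop
  | swap (l₁ l₂ : List α) {x z : α} (h : x < z) :
      ColourStep (l₁ ++ z :: x :: l₂) (l₁ ++ x :: z :: l₂)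
  | knuth (l₁ l₂ : List α) {x y z : α} (hxy : x < y) (hyz : y < z) :
      ColourStep (l₁ ++ x :: z :: y :: l₂) (l₁ ++ z :: x :: y :: l₂)

theorem ColourStep.perm {w w' : List α} (h : ColourStep w w') : w.Perm w' := by
  cases h <;> exact (List.Perm.swap _ _ _).append_left _

theorem ColourStep.append {w w' : List α} (h : ColourStep w w') (u v : List α) :
    ColourStep (u ++ w ++ v) (u ++ w' ++ v) := by
  cases h with
  | swap l₁ l₂ h => simpa using ColourStep.swap (u ++ l₁) (l₂ ++ v) h
  | knuth l₁ l₂ hxy hyz => simpa using ColourStep.knuth (u ++ l₁) (l₂ ++ v) hxy hyz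

theorem swap_lt_iff {i j k : ℕ} (hi : i < k) (hj : j < k) (m : ℕ) :
    Equiv.swap i j m < k ↔ m < k := by
  rw [Equiv.swap_apply_def]
  split_ifs <;> omega

namespace IsDecreasingColouring

variable {k : ℕ} {c : α → ℕ} {l₁ l₂ : List α} {x y z : α}

theorem append_iff {u v : List α} : IsDecreasingColouring k c (u ++ v) ↔
    IsDecreasingColouring k c u ∧ IsDecreasingColouring k c v ∧
      ∀ a ∈ u, ∀ b ∈ v, c a = c b → c a < k → b < a :=
  List.pairwise_append

theorem congr {c' : α → ℕ} {w : List α} (hc : IsDecreasingColouring k c w)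
    (h : ∀ a ∈ w, c' a = c a) : IsDecreasingColouring k c' w :=
  List.Pairwise.imp_of_mem (fun {a b} ha hb => by rw [h a ha, h b hb]; exact id) hc

theorem perm_comp {w : List α} (hc : IsDecreasingColouring k c w) {s : Equiv.Perm ℕ}
    (hs : ∀ m, s m < k ↔ m < k) : IsDecreasingColouring k (s ∘ c) w :=
  List.Pairwise.imp (fun h e hlt => h (s.injective e) ((hs _).1 hlt)) hc

theorem le_head (hc : IsDecreasingColouring k c (x :: l₂)) (hx : c x < k) :
    ∀ b ∈ x :: l₂, c b = c x → b ≤ x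
  | _, hb, e => (List.mem_cons.1 hb).elim Eq.le fun hb =>
      (List.rel_of_pairwise_cons hc hb e.symm hx).le

theorem last_le (hc : IsDecreasingColouring k c (l₁ ++ [z])) (hz : c z < k) :
    ∀ a ∈ l₁ ++ [z], c a = c z → z ≤ a
  | a, ha, e => (List.mem_append.1 ha).elim
      (fun ha => ((append_iff.1 hc).2.2 a ha z (List.mem_singleton_self z) e (e ▸ hz)).le)
      fun ha => (List.mem_singleton.1 ha).ge

theorem swap_adjacent (hc : IsDecreasingColouring k c (l₁ ++ x :: z :: l₂))
    (h : c z = c x → c z < k → x < z) : IsDecreasingColouring k c (l₁ ++ z :: x :: l₂) := by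
  simp only [IsDecreasingColouring, List.pairwise_append, List.pairwise_cons, List.mem_cons,
    forall_eq_or_imp] at hc ⊢
  obtain ⟨first, ⟨⟨-, x_last⟩, z_last, last⟩, cross⟩ := hc
  exact ⟨first, ⟨⟨h, z_last⟩, x_last, last⟩, fun a ha =>
    ⟨(cross a ha).2.1, (cross a ha).1, (cross a ha).2.2⟩⟩

-- The subsequence through `z` and `x` is continued after `z` by `y` and its successors, and the
-- subsequence through `y` is continued before `y` by `x` and its successors.
theorem exchange_tails
    (hc : IsDecreasingColouring k c ((l₁ ++ [z]) ++ x :: y :: l₂))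
    (hxy : x < y) (hyz : y < z) (hdisj : (l₁ ++ [z]).Disjoint (x :: y :: l₂)) (hzx : c z = c x)
    (hx : c x < k) (hy : c y < k) :
    IsDecreasingColouring k
      (fun a => if a ∈ x :: y :: l₂ then Equiv.swap (c x) (c y) (c a) else c a)
      ((l₁ ++ [z]) ++ x :: y :: l₂) := by
  obtain ⟨hu, hv, cross⟩ := append_iff.1 hc
  have le_x := hv.le_head hx
  have le_y : ∀ b ∈ x :: y :: l₂, c b = c y → b ≤ y := fun b hb e =>
    (List.mem_cons.1 hb).elim (fun hbx => hbx ▸ hxy.le) fun hb => le_head hv.of_cons hy b hb e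
  have z_le := hu.last_le (hzx ▸ hx)
  have notMem : ∀ a ∈ l₁ ++ [z], a ∉ x :: y :: l₂ := fun a ha ha' => hdisj ha ha'
  refine append_iff.2 ⟨hu.congr fun a ha => if_neg (notMem a ha), ?_, fun a ha b hb => ?_⟩
  · exact (hv.perm_comp (swap_lt_iff hx hy)).congr fun a ha => if_pos ha
  · rw [if_neg (notMem a ha), if_pos hb]
    intro e hlt
    rcases eq_or_ne (c b) (c x) with hbx | hbx
    · rw [hbx, Equiv.swap_apply_left] at e
      exact (le_x b hb hbx).trans_lt (hxy.trans (cross a ha y (by simp) e hlt))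
    rcases eq_or_ne (c b) (c y) with hby | hby
    · rw [hby, Equiv.swap_apply_right] at e
      exact (le_y b hb hby).trans_lt (hyz.trans_le (z_le a ha (e.trans hzx.symm)))
    · exact cross a ha b hb (e.trans (Equiv.swap_apply_of_ne_of_ne hbx hby)) hlt

theorem exchange_letters (hc : IsDecreasingColouring k c ((l₁ ++ [z]) ++ x :: y :: l₂))
    (hxy : x < y) (hyz : y < z) (hnodup : ((l₁ ++ [z]) ++ x :: y :: l₂).Nodup) (hzx : c z = c x)
    (hx : c x < k) (hy : k ≤ c y) :
    IsDecreasingColouring k (c ∘ Equiv.swap x y) ((l₁ ++ [z]) ++ x :: y :: l₂) := by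
  obtain ⟨hu, hv, cross⟩ := append_iff.1 hc
  have le_x := hv.le_head hx
  have z_le := hu.last_le (hzx ▸ hx)
  obtain ⟨-, nodup_v, disj⟩ := List.nodup_append'.1 hnodup
  have ne_of_mem (a) (ha : a ∈ l₁ ++ [z]) : a ≠ x ∧ a ≠ y :=
    ⟨fun e => disj ha (by simp [e]), fun e => disj ha (by simp [e])⟩
  have ne_of_mem_tail (b) (hb : b ∈ l₂) : b ≠ x ∧ b ≠ y := by grind
  have comp_eq {a} (ha : a ≠ x ∧ a ≠ y) : (c ∘ Equiv.swap x y) a = c a :=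
    congrArg c (Equiv.swap_apply_of_ne_of_ne ha.1 ha.2)
  have comp_x : (c ∘ Equiv.swap x y) x = c y := congrArg c (Equiv.swap_apply_left x y)
  have comp_y : (c ∘ Equiv.swap x y) y = c x := congrArg c (Equiv.swap_apply_right x y)
  refine append_iff.2 ⟨hu.congr fun a ha => comp_eq (ne_of_mem a ha), ?_, fun a ha b hb => ?_⟩
  · have htail : IsDecreasingColouring k c l₂ := hv.of_cons.of_cons
    refine .cons (fun _ _ _ hlt => ?_) (.cons (fun b hb e _ => ?_)
      (htail.congr fun b hb => comp_eq (ne_of_mem_tail b hb)))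
    · exact absurd (comp_x ▸ hlt) hy.not_gt
    · rw [comp_y, comp_eq (ne_of_mem_tail b hb)] at e
      exact (le_x b (by simp [hb]) e.symm).trans_lt hxy
  · rw [comp_eq (ne_of_mem a ha)]
    intro e hlt
    rcases List.mem_cons.1 hb with rfl | hb'
    · exact absurd (comp_x ▸ e ▸ hlt) hy.not_gt
    rcases List.mem_cons.1 hb' with rfl | hb'
    · exact hyz.trans_le (z_le a ha (e.trans (comp_y.trans hzx.symm)))
    · exact cross a ha b hb (e.trans (comp_eq (ne_of_mem_tail b hb'))) hlt

theorem exists_knuth [Fintype α] (hc : IsDecreasingColouring k c (l₁ ++ z :: x :: y :: l₂))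
    (hxy : x < y) (hyz : y < z) (hnodup : (l₁ ++ z :: x :: y :: l₂).Nodup) (hzx : c z = c x)
    (hx : c x < k) : ∃ c', IsDecreasingColouring k c' (l₁ ++ x :: z :: y :: l₂) ∧
      #{a | c' a < k} = #{a | c a < k} := by
  have reassoc : l₁ ++ z :: x :: y :: l₂ = (l₁ ++ [z]) ++ x :: y :: l₂ := by simp
  have colour_ne : c x ≠ c y := fun e => hxy.not_gt <|
    List.rel_of_pairwise_cons (append_iff.1 hc).2.1.of_cons (by simp) e hx
  rw [reassoc] at hc hnodup
  have disj := (List.nodup_append'.1 hnodup).2.2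
  rcases lt_or_ge (c y) k with hy | hy
  · have exchanged := hc.exchange_tails hxy hyz disj hzx hx hy
    rw [← reassoc] at exchanged
    refine ⟨_, exchanged.swap_adjacent fun e => absurd e ?_, ?_⟩
    · have hz : z ∉ x :: y :: l₂ := disj (by simp)
      simpa [hz, hzx] using colour_ne.symm
    · refine congrArg card (filter_congr fun a _ => ?_)
      split_ifs
      · exact swap_lt_iff hx hy (c a)
      · rfl
  · have exchanged := hc.exchange_letters hxy hyz hnodup hzx hx hy
    rw [← reassoc] at exchanged
    refine ⟨_, exchanged.swap_adjacent fun e => absurd e ?_, ?_⟩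
    · rw [Function.comp_apply, Function.comp_apply, Equiv.swap_apply_left,
        Equiv.swap_apply_of_ne_of_ne (hxy.trans hyz).ne' hyz.ne', hzx]
      exact colour_ne.symm
    · exact card_equiv (Equiv.swap x y) fun a => by simp

theorem exists_of_colourStep [Fintype α] {w w' : List α} (h : ColourStep w w') (hnodup : w'.Nodup)
    (hc : IsDecreasingColouring k c w') :
    ∃ c', IsDecreasingColouring k c' w ∧ #{a | c' a < k} = #{a | c a < k} := by
  cases h with
  | swap l₁ l₂ h => exact ⟨c, hc.swap_adjacent fun _ _ => h, rfl⟩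
  | @knuth l₁ l₂ x y z hxy hyz =>
    by_cases hzx : c z = c x ∧ c x < k
    · exact hc.exists_knuth hxy hyz hnodup hzx.1 hzx.2
    · exact ⟨c, hc.swap_adjacent fun e hlt => absurd ⟨e.symm, hlt⟩ hzx, rfl⟩

theorem exists_of_reflTransGen [Fintype α] {w w' : List α}
    (h : Relation.ReflTransGen ColourStep w w') (hnodup : w.Nodup)
    (hc : IsDecreasingColouring k c w') :
    ∃ c', IsDecreasingColouring k c' w ∧ #{a | c' a < k} = #{a | c a < k} := by
  induction h using Relation.ReflTransGen.head_induction_on with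
  | refl => exact ⟨c, hc, rfl⟩
  | head hstep _ ih =>
    have hnodup' := hstep.perm.nodup_iff.1 hnodup
    obtain ⟨c₁, hc₁, card₁⟩ := ih hnodup'
    obtain ⟨c₂, hc₂, card₂⟩ := hc₁.exists_of_colourStep hstep hnodup'
    exact ⟨c₂, hc₂, card₂.trans card₁⟩

end IsDecreasingColouring

section ReadingWord

open Relation

theorem reflTransGen_append {w w' : List α} (h : ReflTransGen ColourStep w w')
    (u v : List α) : ReflTransGen ColourStep (u ++ w ++ v) (u ++ w' ++ v) :=
  h.lift (fun l => u ++ l ++ v) fun _ _ h => h.append u v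

theorem reflTransGen_cons {w w' : List α} (h : ReflTransGen ColourStep w w') (a : α) :
    ReflTransGen ColourStep (a :: w) (a :: w') := by
  simpa using reflTransGen_append h [a] []

theorem reflTransGen_concat_of_forall_lt {x : α} {r : List α} (h : ∀ z ∈ r, x < z) :
    ReflTransGen ColourStep (r ++ [x]) (x :: r) := by
  induction r with
  | nil => exact .refl
  | cons a r ih =>
    rw [List.forall_mem_cons] at h
    exact (reflTransGen_cons (ih h.2) a).tail (.swap [] r h.1)

theorem exists_rowInsert_fst_eq_cons {a x y : α} {r : List α} (hr : (a :: r).Pairwise (· < ·))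
    (hax : a < x) (hy : (rowInsert x r).2 = some y) :
    ∃ b l, (rowInsert x r).1 = b :: l ∧ a < b ∧ b < y := by
  obtain ⟨b, l, hbl⟩ := List.exists_cons_of_ne_nil (List.ne_nil_of_mem (mem_rowInsert_self x r))
  refine ⟨b, l, hbl, ?_, lt_of_le_of_lt ?_ (lt_of_rowInsert_eq_some hy)⟩
  · have hb : b ∈ x :: r := (rowInsert_perm x r).mem_iff.1 (by simp [hbl])
    exact (List.mem_cons.1 hb).elim (fun hbx => hbx ▸ hax) (List.rel_of_pairwise_cons hr)
  · have hx := mem_rowInsert_self x r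
    have sorted := rowInsert_pairwise (x := x) (hr.of_cons.imp le_of_lt)
    rw [hbl] at hx sorted
    exact (List.mem_cons.1 hx).elim Eq.ge (List.rel_of_pairwise_cons sorted)

theorem reflTransGen_rowInsert {x y : α} {r : List α} (hr : r.Pairwise (· < ·)) (hx : x ∉ r)
    (hy : (rowInsert x r).2 = some y) :
    ReflTransGen ColourStep (r ++ [x]) (y :: (rowInsert x r).1) := by
  induction r with
  | nil => simp [rowInsert] at hy
  | cons a r ih =>
    obtain ⟨hxa, hxr⟩ := not_or.1 (mt List.mem_cons.2 hx)
    rcases lt_or_ge x a with hlt | hle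
    · rw [rowInsert_cons_of_lt hlt] at hy ⊢
      obtain rfl : a = y := Option.some.inj hy
      have h_lt : ∀ z ∈ r, x < z := fun z hz => hlt.trans (List.rel_of_pairwise_cons hr hz)
      exact reflTransGen_cons (reflTransGen_concat_of_forall_lt h_lt) a
    · rw [rowInsert_cons_of_le hle] at hy ⊢
      obtain ⟨b, l, hbl, hab, hby⟩ :=
        exists_rowInsert_fst_eq_cons hr (hle.lt_of_ne (Ne.symm hxa)) hy
      have insert_tail := reflTransGen_cons (ih hr.of_cons hxr hy) a
      simp only [hbl] at insert_tail ⊢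
      exact insert_tail.tail (.knuth [] l hab hby)

theorem rowInsert_fst_of_eq_none {x : α} {r : List α} (h : (rowInsert x r).2 = none) :
    (rowInsert x r).1 = r ++ [x] := by
  induction r with
  | nil => rfl
  | cons a r ih =>
    rcases lt_or_ge x a with hlt | hle
    · simp [rowInsert_cons_of_lt hlt] at h
    · rw [rowInsert_cons_of_le hle] at h ⊢
      exact congrArg (a :: ·) (ih h)

theorem reflTransGen_tableauInsert {T : List (List α)} (hT : ∀ r ∈ T, r.Pairwise (· ≤ ·)) {x : α}
    (hnodup : (x :: T.flatten).Nodup) :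
    ReflTransGen ColourStep (readingWord T ++ [x]) (readingWord (tableauInsert x T)) := by
  induction T generalizing x with
  | nil => exact .refl
  | cons r rs ih =>
    rw [List.forall_mem_cons] at hT
    rcases hy : (rowInsert x r).2 with _ | y
    · rw [tableauInsert_cons_of_eq_none _ hy, readingWord, readingWord,
        rowInsert_fst_of_eq_none hy, List.append_assoc]
    · rw [tableauInsert_cons_of_eq_some _ hy, readingWord, readingWord]
      have nodup_bumped : (y :: rs.flatten).Nodup := by
        have row_perm := (rowInsert_perm x r).append_right rs.flatten
        rw [hy] at row_perm
        exact (row_perm.nodup_iff.2 hnodup).sublist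
          ((List.sublist_append_right _ _).cons_cons y)
      have nodup_row : r.Nodup := hnodup.of_cons.of_append_left
      have notMem_row : x ∉ r := fun h => hnodup.notMem (List.mem_append_left _ h)
      have pairwise_lt : r.Pairwise (· < ·) :=
        (hT.1.and nodup_row).imp fun h => lt_of_le_of_ne h.1 h.2
      have insert_row := reflTransGen_append (reflTransGen_rowInsert pairwise_lt notMem_row hy)
        (readingWord rs) []
      have insert_below := reflTransGen_append (ih hT.2 nodup_bumped) [] (rowInsert x r).1
      simp only [List.append_nil, List.nil_append, List.append_assoc, List.cons_append]
        at insert_row insert_below ⊢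
      exact insert_row.trans insert_below

theorem reflTransGen_insertionTableau {w : List α} (hw : w.Nodup) :
    ReflTransGen ColourStep w (readingWord (insertionTableau w)) := by
  induction w using List.reverseRecOn with
  | nil => exact .refl
  | append_singleton w x ih =>
    have nodup_cons : (x :: (insertionTableau w).flatten).Nodup :=
      (((flatten_insertionTableau_perm w).cons x).trans
        (List.perm_append_singleton x w).symm).nodup_iff.2 hw
    rw [insertionTableau_concat]
    exact (reflTransGen_append (ih hw.of_append_left) [] [x]).trans
      (reflTransGen_tableauInsert (isTableau_insertionTableau w).1 nodup_cons)

theorem isDecreasingColouring_readingWord {T : List (List α)} (hT : T.Pairwise Below) {c : α → ℕ}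
    (hc : ∀ r ∈ T, ∀ (j : ℕ) a, r[j]? = some a → c a = j) (k : ℕ) :
    IsDecreasingColouring k c (readingWord T) := by
  induction T with
  | nil => exact List.Pairwise.nil
  | cons r rs ih =>
    rw [List.pairwise_cons] at hT
    rw [List.forall_mem_cons] at hc
    refine IsDecreasingColouring.append_iff.2 ⟨ih hT.2 hc.2, ?_, fun a ha b hb e _ => ?_⟩
    · refine List.pairwise_iff_getElem.2 fun i j hi hj hij e => absurd e ?_
      rw [hc.1 i _ (List.getElem?_eq_getElem hi), hc.1 j _ (List.getElem?_eq_getElem hj)]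
      exact hij.ne
    · obtain ⟨s, hs, has⟩ := List.mem_flatten.1 ((readingWord_perm rs).mem_iff.1 ha)
      obtain ⟨i, hi⟩ := List.mem_iff_getElem?.1 has
      obtain ⟨j, hj⟩ := List.mem_iff_getElem?.1 hb
      obtain ⟨b', hb', hlt⟩ := (hT.1 s hs).exists_getElem?_lt hi
      rw [← hc.2 s hs i a hi, e, hc.1 j b hj, hj] at hb'
      exact Option.some.inj hb' ▸ hlt

end ReadingWord

end Decreasing

-- The columns of the insertion tableau are decreasing subsequences of its reading word.
theorem exists_isDecreasingColouring_permWord {n : ℕ} (σ : Equiv.Perm (Fin n)) (k : ℕ) :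
    ∃ c, IsDecreasingColouring k c (permWord σ) ∧
      #{a | c a < k} = rowSum (transpose (rsShape σ)) k := by
  have : Trans (Below (α := Fin n)) Below Below := ⟨Below.trans⟩
  have colour_eq : ∀ r ∈ insertionTableau (permWord σ), ∀ (j : ℕ) a, r[j]? = some a →
      (insertionFilling σ a).2 = j := by
    intro r hr j a ha
    obtain ⟨i, hi, rfl⟩ := List.getElem_of_mem hr
    rw [(insertionFilling_eq_iff σ a i j).2 (by rwa [List.getD_eq_getElem _ _ hi])]
  have columns_decreasing := isDecreasingColouring_readingWord
    (List.isChain_iff_pairwise.1 (isTableau_insertionTableau (permWord σ)).2) colour_eq k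
  have nodup : (permWord σ).Nodup := List.nodup_ofFn.2 σ.injective
  rw [← (isColumnStandard_insertionFilling σ).hasShape_snd.card_lt]
  exact columns_decreasing.exists_of_reflTransGen (reflTransGen_insertionTableau nodup) nodup

theorem exists_decreasing_colouring {n : ℕ} (σ : Equiv.Perm (Fin n)) (k : ℕ) :
    ∃ c : Fin n → ℕ, (∀ i j, i < j → c i = c j → c i < k → σ j < σ i) ∧
      #{i | c i < k} = rowSum (transpose (rsShape σ)) k := by
  obtain ⟨c, hc, card_eq⟩ := exists_isDecreasingColouring_permWord σ k
  refine ⟨c ∘ σ, fun i j hij => List.pairwise_ofFn.1 hc hij, ?_⟩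
  exact (card_equiv σ fun i => by simp).trans card_eq

/-! ### Matrix coefficients of the permutation modules -/

section MatrixCoefficients

theorem forall_smul_asModule_eq_zero_iff {R G V : Type*} [CommRing R] [Group G] [AddCommGroup V]
    [Module R V] (ρ : Representation R G V) (x : MonoidAlgebra R G) :
    (∀ m : ρ.asModule, x • m = 0) ↔ ρ.asAlgebraHom x = 0 := by
  rw [LinearMap.ext_iff, ← ρ.asModuleEquiv.toEquiv.forall_congr_right]
  refine forall_congr' fun m => ?_
  rw [← ρ.asModuleEquiv.map_eq_zero_iff, ρ.asModuleEquiv_map_smul]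
  rfl

theorem asAlgebraHom_ofMulAction_eq_zero_iff {R G X : Type*} [CommRing R] [Group G] [MulAction G X]
    (x : MonoidAlgebra R G) :
    (Representation.ofMulAction R G X).asAlgebraHom x = 0 ↔
      ∀ a b, ((Representation.ofMulAction R G X).asAlgebraHom x
        (MonoidAlgebra.single a 1)).coeff b = 0 := by
  refine ⟨fun h a b => by rw [h]; rfl, fun h => LinearMap.ext fun v => ?_⟩
  induction v using MonoidAlgebra.induction_linear with
  | zero => rw [map_zero, map_zero]
  | add v w hv hw => rw [map_add, map_add, hv, hw]
  | single a r =>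
    have single_eq_smul : (MonoidAlgebra.single a r : MonoidAlgebra R X) =
        r • MonoidAlgebra.single a 1 := by simp
    rw [single_eq_smul, map_smul, map_smul]
    exact congrArg (r • ·) (MonoidAlgebra.ext (Finsupp.ext (h a)))

variable {R : Type*} [CommRing R] {ι α : Type*} [Fintype ι] [DecidableEq α]

/-- The functional on `R Sym(ι)` with value `1` at the permutations that carry `s` to `t`, and `0`
at the others. For `s` and `t` of shape `p`, viewed as points of `Sym(n)/Sym(p)`, these are the
matrix coefficients of `M(p)`. -/
noncomputable def matrixCoeff (R : Type*) [CommRing R] (s t : ι → α) :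
    MonoidAlgebra R (Equiv.Perm ι) →ₗ[R] R :=
  Finsupp.linearCombination R
      (fun σ : Equiv.Perm ι => if ∀ i, t (σ i) = s i then (1 : R) else 0) ∘ₗ
    (MonoidAlgebra.coeffLinearEquiv R).toLinearMap

theorem matrixCoeff_single (s t : ι → α) (σ : Equiv.Perm ι) (r : R) :
    matrixCoeff R s t (MonoidAlgebra.single σ r) = if ∀ i, t (σ i) = s i then r else 0 := by
  simp [matrixCoeff]

theorem matrixCoeff_of (s t : ι → α) (σ : Equiv.Perm ι) :
    matrixCoeff R s t (MonoidAlgebra.of R _ σ) = if ∀ i, t (σ i) = s i then 1 else 0 :=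
  matrixCoeff_single s t σ 1

variable {n : ℕ} (p : n.Partition)

theorem smul_mk_eq_mk_iff (σ g h : Equiv.Perm (Fin n)) :
    σ • (QuotientGroup.mk g : Equiv.Perm (Fin n) ⧸ youngSubgroup p) = QuotientGroup.mk h ↔
      ∀ i, blockIndex p (h⁻¹ (σ i)) = blockIndex p (g⁻¹ i) := by
  rw [MulAction.Quotient.smul_mk, eq_comm, QuotientGroup.eq, mem_youngSubgroup_iff,
    ← g⁻¹.forall_congr_right]
  simp

theorem coeff_asAlgebraHom_single (g h : Equiv.Perm (Fin n)) (x : SymAlg R n) :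
    ((Representation.ofMulAction R (Equiv.Perm (Fin n))
      (Equiv.Perm (Fin n) ⧸ youngSubgroup p)).asAlgebraHom x
        (MonoidAlgebra.single (QuotientGroup.mk g) 1)).coeff (QuotientGroup.mk h) =
      matrixCoeff R (fun i => blockIndex p (g⁻¹ i)) (fun i => blockIndex p (h⁻¹ i)) x := by
  classical
  induction x using MonoidAlgebra.induction_linear with
  | zero => simp
  | add x y hx hy => simp [hx, hy]
  | single σ r =>
    rw [Representation.asAlgebraHom_single, LinearMap.smul_apply,
      Representation.ofMulAction_single, matrixCoeff_single, MonoidAlgebra.coeff_smul_apply,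
      MonoidAlgebra.coeff_single, Finsupp.single_apply]
    simp only [smul_mk_eq_mk_iff]
    split_ifs <;> simp

theorem hasShape_iff_exists_perm (s : Fin n → ℕ) :
    HasShape p s ↔ ∃ g : Equiv.Perm (Fin n), s = fun i => blockIndex p (g⁻¹ i) := by
  refine ⟨fun hs => ?_, ?_⟩
  · obtain ⟨e, he⟩ := hs.exists_perm (hasShape_blockIndex p)
    exact ⟨e⁻¹, funext fun i => by rw [inv_inv, he]⟩
  · rintro ⟨g, rfl⟩ r
    rw [← hasShape_blockIndex p r]
    exact card_equiv g⁻¹ fun i => by simp only [mem_filter, mem_univ, true_and]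

theorem forall_smul_permModule_eq_zero_iff (x : SymAlg R n) :
    (∀ m : PermModule R p, x • m = 0) ↔
      ∀ s t, HasShape p s → HasShape p t → matrixCoeff R s t x = 0 := by
  rw [forall_smul_asModule_eq_zero_iff, asAlgebraHom_ofMulAction_eq_zero_iff]
  simp only [hasShape_iff_exists_perm, QuotientGroup.forall_mk, coeff_asAlgebraHom_single]
  exact ⟨fun h s t ⟨g, hg⟩ ⟨g', hg'⟩ => hg ▸ hg' ▸ h g g', fun h g g' => h _ _ ⟨g, rfl⟩ ⟨g', rfl⟩⟩

end MatrixCoefficients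

/-! ### Signed sums -/

section SignedSums

theorem card_filter_lt_le {ι γ : Type*} [DecidableEq γ] (S : Finset ι) (t : ι → ℕ)
    (f : ι → γ) (k : ℕ) (h : ∀ i ∈ S, ∀ j ∈ S, f i = f j → t i = t j → i = j) :
    #{i ∈ S | t i < k} ≤ ∑ c ∈ S.image f, min k #{i ∈ S | f i = c} := by
  have maps_to : Set.MapsTo f ({i ∈ S | t i < k} : Finset ι) (S.image f) := fun i hi =>
    mem_image_of_mem f (mem_filter.1 hi).1
  rw [card_eq_sum_card_fiberwise maps_to]
  refine sum_le_sum fun c _ => le_min ?_ (card_le_card (filter_subset_filter _ (filter_subset _ _)))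
  have maps_to_range :
      Set.MapsTo t ({i ∈ {i ∈ S | t i < k} | f i = c} : Finset ι) (range k) := fun i hi =>
    mem_range.2 (mem_filter.1 (mem_filter.1 hi).1).2
  refine (card_le_card_of_injOn t maps_to_range fun i hi j hj hij => ?_).trans_eq (card_range k)
  simp only [coe_filter, mem_filter, Set.mem_ofPred_eq] at hi hj
  exact h i hi.1.1 j hj.1.1 (hi.2.trans hj.2.symm) hij

variable {R : Type*} [CommRing R] {ι α γ : Type*} [Fintype ι] [DecidableEq ι] [DecidableEq α]
  [DecidableEq γ]

/-- The signed sum of the permutations that preserve the fibres of `f`; for `f = blockIndex p` it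
is the image of `youngSum R p` under `†`. -/
noncomputable def signedSum (R : Type*) [CommRing R] (f : ι → γ) :
    MonoidAlgebra R (Equiv.Perm ι) :=
  ∑ κ : Equiv.Perm ι with ∀ i, f (κ i) = f i,
    ((Equiv.Perm.sign κ : ℤˣ) : ℤ) • MonoidAlgebra.of R _ κ

theorem matrixCoeff_signedSum_mul (f : ι → γ) (s t : ι → α) (w : Equiv.Perm ι) :
    matrixCoeff R s t (signedSum R f * MonoidAlgebra.of R _ w) =
      ∑ κ : Equiv.Perm ι with ∀ i, f (κ i) = f i,
        ((Equiv.Perm.sign κ : ℤˣ) : ℤ) • (if ∀ i, t (κ (w i)) = s i then (1 : R) else 0) := by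
  rw [signedSum, sum_mul, map_sum]
  refine sum_congr rfl fun κ _ => ?_
  rw [smul_mul_assoc, ← map_mul, map_zsmul, matrixCoeff_of]
  rfl

section NonzeroCoefficient

variable {f : ι → γ} {s t : ι → α} {w : Equiv.Perm ι}

theorem exists_perm_of_matrixCoeff_ne_zero
    (h : matrixCoeff R s t (signedSum R f * MonoidAlgebra.of R _ w) ≠ 0) :
    ∃ κ : Equiv.Perm ι, (∀ i, f (κ i) = f i) ∧ ∀ i, t (κ (w i)) = s i := by
  rw [matrixCoeff_signedSum_mul] at h
  obtain ⟨κ, hκ, summand_ne_zero⟩ := exists_ne_zero_of_sum_ne_zero h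
  exact ⟨κ, (mem_filter.1 hκ).2, by_contra fun hc => summand_ne_zero (by rw [if_neg hc, smul_zero])⟩

-- Otherwise `κ ↦ swap i j * κ` is a sign-reversing involution on the summands of the coefficient.
theorem eq_of_matrixCoeff_ne_zero
    (h : matrixCoeff R s t (signedSum R f * MonoidAlgebra.of R _ w) ≠ 0) {i j : ι}
    (hf : f i = f j) (ht : t i = t j) : i = j := by
  by_contra hij
  refine h ((matrixCoeff_signedSum_mul f s t w).trans
    (sum_involution (fun κ _ => Equiv.swap i j * κ) ?_ ?_ ?_ ?_))
  · intro κ _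
    simp only [Equiv.Perm.sign_mul, Equiv.Perm.sign_swap hij, Equiv.Perm.mul_apply,
      Equiv.apply_swap_eq_self ht]
    split_ifs <;> simp
  · exact fun κ _ _ hκ => hij (Equiv.swap_eq_one_iff.1 (mul_eq_right.1 hκ))
  · intro κ hκ
    simpa only [mem_filter, mem_univ, true_and, Equiv.Perm.mul_apply,
      Equiv.apply_swap_eq_self hf] using hκ
  · exact fun κ _ => Equiv.swap_mul_self_mul i j κ

theorem eq_of_matrixCoeff_ne_zero_right
    (h : matrixCoeff R s t (signedSum R f * MonoidAlgebra.of R _ w) ≠ 0) {i j : ι}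
    (hf : f (w i) = f (w j)) (hs : s i = s j) : i = j := by
  obtain ⟨κ, hκf, hκt⟩ := exists_perm_of_matrixCoeff_ne_zero h
  refine w.injective (κ.injective (eq_of_matrixCoeff_ne_zero h ?_ ?_))
  · rw [hκf, hκf, hf]
  · rw [hκt, hκt, hs]

end NonzeroCoefficient

theorem le_transpose_of_matrixCoeff_ne_zero {n : ℕ} {p q : n.Partition} {f s t : ι → ℕ}
    {w : Equiv.Perm ι} (hf : HasShape p f) (ht : HasShape q t)
    (h : matrixCoeff R s t (signedSum R f * MonoidAlgebra.of R _ w) ≠ 0) : q ≤ transpose p := by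
  intro k
  calc rowSum q k = #{i | t i < k} := (ht.card_lt k).symm
    _ ≤ ∑ c ∈ univ.image f, min k #{i | f i = c} :=
      card_filter_lt_le univ t f k fun i _ j _ => eq_of_matrixCoeff_ne_zero h
    _ = ∑ c ∈ univ.image f, min k (part p c) := sum_congr rfl fun c _ => by rw [hf c]
    _ ≤ ∑ c ∈ range n, min k (part p c) := sum_le_sum_of_ne_zero fun c _ hc =>
      mem_range.2 (lt_of_part_ne_zero fun h0 => hc (by rw [h0, Nat.min_zero]))
    _ = rowSum (transpose p) k := (rowSum_transpose p k).symm

variable {n : ℕ}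

theorem dagger_of (σ : Equiv.Perm (Fin n)) : dagger R n (MonoidAlgebra.of R _ σ) =
    ((Equiv.Perm.sign σ : ℤˣ) : ℤ) • MonoidAlgebra.of R _ σ := by
  rw [dagger, MonoidAlgebra.lift_of]
  rfl

theorem dagger_youngSum (p : n.Partition) :
    dagger R n (youngSum R p) = signedSum R (blockIndex p) := by
  simp only [youngSum, signedSum, map_sum, dagger_of, mem_youngSubgroup_iff]
  congr!

theorem dagger_smul_permModule_eq_zero {Γ : Set n.Partition} (hΓ : IsUpperSet Γ)
    {q : n.Partition} (hq : q ∈ Γ) {x : SymAlg R n} (hx : x ∈ youngIdeal R (transpose '' Γ)ᶜ)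
    (m : PermModule R q) : dagger R n x • m = 0 := by
  rw [youngIdeal] at hx
  induction hx using TwoSidedIdeal.span_induction generalizing m with
  | mem x hx =>
    obtain ⟨p, hp, rfl⟩ := hx
    refine (forall_smul_permModule_eq_zero_iff q _).2 (fun s t _ ht => by_contra fun hne => ?_) m
    rw [dagger_youngSum, ← mul_one (signedSum R _), ← map_one (MonoidAlgebra.of R _)] at hne
    have hle : q ≤ transpose p :=
      le_transpose_of_matrixCoeff_ne_zero (hasShape_blockIndex p) ht hne
    exact hp ⟨transpose p, hΓ hle hq, transpose_transpose p⟩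
  | zero => rw [map_zero, zero_smul]
  | add x y _ _ hx hy => rw [map_add, add_smul, hx, hy, add_zero]
  | neg x _ hx => rw [map_neg, neg_smul, hx, neg_zero]
  | left_absorb a x _ hx => rw [map_mul, mul_smul, hx, smul_zero]
  | right_absorb b x _ hx => rw [map_mul, mul_smul, hx]

end SignedSums

/-! ### Straightening modulo `I_R(Δ)†` -/

section Straightening

variable {R : Type*} [CommRing R]

section SignedSum

variable {ι γ : Type*} [Fintype ι] [DecidableEq ι] [DecidableEq γ]

theorem signedSum_comp_perm (f : ι → γ) (g : Equiv.Perm ι) :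
    signedSum R (f ∘ g) =
      MonoidAlgebra.of R _ g⁻¹ * signedSum R f * MonoidAlgebra.of R _ g := by
  rw [signedSum, signedSum, mul_sum, sum_mul]
  refine sum_equiv (MulAut.conj g).toEquiv (fun κ => ?_) fun κ _ => ?_
  · simp only [mem_filter, mem_univ, true_and]
    rw [← g.forall_congr_right (q := fun i => f ((MulAut.conj g).toEquiv κ i) = f i)]
    simp
  · have sign_conj : Equiv.Perm.sign (g * κ * g⁻¹) = Equiv.Perm.sign κ := by simp [mul_right_comm]
    simp only [MulEquiv.toEquiv_eq_coe, MulEquiv.coe_toEquiv, MulAut.conj_apply, sign_conj,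
      mul_smul_comm, smul_mul_assoc, ← map_mul]
    congr 2
    group

theorem signedSum_eq_one_add (f : ι → γ) :
    signedSum R f = 1 + ∑ κ ∈ ({κ | ∀ i, f (κ i) = f i} : Finset (Equiv.Perm ι)).erase 1,
      ((Equiv.Perm.sign κ : ℤˣ) : ℤ) • MonoidAlgebra.of R _ κ := by
  rw [signedSum, ← add_sum_erase (a := (1 : Equiv.Perm ι)) _ _ (by simp), Equiv.Perm.sign_one,
    Units.val_one, one_smul, map_one]

end SignedSum

variable {n : ℕ}

theorem dagger_dagger (x : SymAlg R n) : dagger R n (dagger R n x) = x := by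
  have dagger_comp_dagger : (dagger R n).comp (dagger R n) = AlgHom.id R _ := by
    refine MonoidAlgebra.algHom_ext (fun σ => ?_) (Subsingleton.elim _ _)
    change dagger R n (dagger R n (MonoidAlgebra.of R _ σ)) = MonoidAlgebra.of R _ σ
    rw [dagger_of, map_zsmul, dagger_of, smul_smul, ← Units.val_mul, Int.units_mul_self,
      Units.val_one, one_smul]
  exact DFunLike.congr_fun dagger_comp_dagger x

/-- `I_R(Δ)†` as an `R`-submodule of `R Sym(n)`. -/
noncomputable def daggerIdeal (R : Type*) [CommRing R] {n : ℕ} (Δ : Set n.Partition) :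
    Submodule R (SymAlg R n) :=
  ((youngIdeal R Δ).asIdeal.restrictScalars R).map (dagger R n).toLinearMap

theorem coe_daggerIdeal (Δ : Set n.Partition) :
    (daggerIdeal R Δ : Set (SymAlg R n)) = dagger R n '' (youngIdeal R Δ : Set (SymAlg R n)) :=
  rfl

theorem mul_mul_mem_daggerIdeal {Δ : Set n.Partition} (a b : SymAlg R n) {x : SymAlg R n}
    (hx : x ∈ daggerIdeal R Δ) : a * x * b ∈ daggerIdeal R Δ := by
  obtain ⟨x, hx, rfl⟩ := hx
  refine ⟨dagger R n a * x * dagger R n b, (youngIdeal R Δ).mul_mem_right _ _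
    ((youngIdeal R Δ).mul_mem_left _ _ hx), ?_⟩
  simp only [AlgHom.toLinearMap_apply, map_mul, dagger_dagger]

theorem signedSum_mem_daggerIdeal {Δ : Set n.Partition} {p : n.Partition} (hp : p ∈ Δ)
    {f : Fin n → ℕ} (hf : HasShape p f) : signedSum R f ∈ daggerIdeal R Δ := by
  obtain ⟨g, hg⟩ := hf.exists_perm (hasShape_blockIndex p)
  obtain rfl : blockIndex p ∘ g = f := funext hg
  rw [signedSum_comp_perm, ← dagger_youngSum]
  exact mul_mul_mem_daggerIdeal _ _ ⟨_, TwoSidedIdeal.subset_span ⟨p, hp, rfl⟩, rfl⟩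

-- At the first `i` moved by `κ`, the value of `σ` drops from `σ i` to `σ (κ i)`.
theorem toLex_mul_lt {ι α : Type*} [LinearOrder ι] [WellFoundedLT ι] [Preorder α]
    {σ : ι → α} {κ : Equiv.Perm ι} (hκ : κ ≠ 1) (h : ∀ i, i < κ i → σ (κ i) < σ i) :
    toLex (σ ∘ κ) < toLex σ := by
  have exists_moved : ∃ i, κ i ≠ i := not_forall.1 fun hc => hκ (Equiv.ext hc)
  obtain ⟨i, moved, fixed_below⟩ := WellFounded.has_min (wellFounded_lt (α := ι)) _ exists_moved
  have fixed : ∀ j < i, κ j = j := fun j hj => not_not.1 fun hc => fixed_below j hc hj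
  have lt_image : i < κ i := lt_of_not_ge fun hle =>
    moved (κ.injective (fixed _ (hle.lt_of_ne moved)))
  exact ⟨i, fun j hj => congrArg σ (fixed j hj), h i lt_image⟩

theorem exists_hasShape_decreasing {μ : n.Partition} {σ : Equiv.Perm (Fin n)}
    (hσ : ¬ μ ≤ rsShape σ) :
    ∃ (p : n.Partition) (f : Fin n → ℕ), HasShape p f ∧ ¬ p ≤ transpose μ ∧
      ∀ i j, i < j → f i = f j → σ j < σ i := by
  have not_transpose_le : ¬ transpose (rsShape σ) ≤ transpose μ := fun h => hσ (by
    simpa only [transpose_transpose] using transpose_antitone h)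
  obtain ⟨k, hk⟩ := not_forall.1 not_transpose_le
  obtain ⟨c, c_decreasing, card_c⟩ := exists_decreasing_colouring σ k
  -- The uncoloured positions form singleton fibres.
  let f (i : Fin n) : Fin k ⊕ Fin n := if h : c i < k then .inl ⟨c i, h⟩ else .inr i
  obtain ⟨p, e, hp⟩ := exists_hasShape (Fintype.card_fin n) f
  refine ⟨p, e ∘ f, hp, fun hle => hk ?_, fun i j hij hf => ?_⟩
  · let T : Finset ℕ := univ.image fun a : Fin k => e (.inl a)
    have mem_T (i : Fin n) : (e ∘ f) i ∈ T ↔ c i < k := by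
      by_cases hi : c i < k <;> simp [T, f, hi]
    calc rowSum (transpose (rsShape σ)) k = #{i | (e ∘ f) i ∈ T} := by simp only [mem_T, card_c]
      _ = ∑ r ∈ T, part p r := hp.card_mem T
      _ ≤ rowSum p #T := sum_part_le_rowSum p T
      _ ≤ rowSum p k := rowSum_mono p (card_image_le.trans_eq (Fintype.card_fin k))
      _ ≤ rowSum (transpose μ) k := hle k
  · have f_eq : f i = f j := e.injective hf
    by_cases hi : c i < k <;> by_cases hj : c j < k
    · exact c_decreasing i j hij (by simpa [f, hi, hj] using f_eq) hi
    · simp [f, hi, hj] at f_eq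
    · simp [f, hi, hj] at f_eq
    · exact absurd (by simpa [f, hi, hj] using f_eq) hij.ne

theorem of_mem_shapeSpan_sup_daggerIdeal (μ : n.Partition) (σ : Equiv.Perm (Fin n)) :
    MonoidAlgebra.of R _ σ ∈ shapeSpan R (Set.Ici μ) ⊔ daggerIdeal R (transpose '' Set.Ici μ)ᶜ := by
  have wf_lex : WellFounded fun σ τ : Equiv.Perm (Fin n) => toLex ⇑σ < toLex ⇑τ :=
    InvImage.wf (fun σ : Equiv.Perm (Fin n) => toLex ⇑σ) wellFounded_lt
  induction σ using wf_lex.induction with | h σ ih =>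
  by_cases hσ : μ ≤ rsShape σ
  · exact Submodule.mem_sup_left (Submodule.subset_span ⟨σ, hσ, rfl⟩)
  obtain ⟨p, f, hf, hp, decreasing⟩ := exists_hasShape_decreasing hσ
  have p_mem : p ∈ (transpose '' Set.Ici μ)ᶜ := by
    rintro ⟨ν, hν, rfl⟩
    exact hp (transpose_antitone hν)
  have product_mem := mul_mul_mem_daggerIdeal (MonoidAlgebra.of R _ σ) 1
    (signedSum_mem_daggerIdeal p_mem hf)
  rw [mul_one, signedSum_eq_one_add, mul_add, mul_one, mul_sum] at product_mem
  refine (Submodule.add_mem_iff_left _ (Submodule.sum_mem _ fun κ hκ => ?_)).1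
    (Submodule.mem_sup_right product_mem)
  obtain ⟨hκ_ne, hκ⟩ : κ ≠ 1 ∧ ∀ i, f (κ i) = f i := by simpa using hκ
  rw [mul_smul_comm, ← map_mul]
  exact zsmul_mem (ih _ (toLex_mul_lt hκ_ne fun i hi => decreasing i _ hi (hκ i).symm)) _

theorem shapeSpan_sup_daggerIdeal (μ : n.Partition) :
    shapeSpan R (Set.Ici μ) ⊔ daggerIdeal R (transpose '' Set.Ici μ)ᶜ = ⊤ := by
  refine eq_top_iff.2 fun x _ => ?_
  induction x using MonoidAlgebra.induction_on with
  | of σ => exact of_mem_shapeSpan_sup_daggerIdeal μ σ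
  | add x y hx hy => exact Submodule.add_mem _ (hx trivial) (hy trivial)
  | smul r x hx => exact Submodule.smul_mem _ r (hx trivial)

end Straightening

/-! ### Unitriangularity of the Robinson–Schensted coefficients -/

theorem surjective_pi_of_unitriangular {R A ι : Type*} [CommRing R] [AddCommGroup A] [Module R A]
    [Finite ι] [PartialOrder ι] (φ : ι → A →ₗ[R] R) (v : ι → A) (hdiag : ∀ i, φ i (v i) = 1)
    (htri : ∀ i j, φ i (v j) ≠ 0 → i ≤ j) : Function.Surjective (LinearMap.pi φ) := by
  classical
  have := Fintype.ofFinite ι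
  have single_mem (j : ι) : (Pi.single j 1 : ι → R) ∈ LinearMap.range (LinearMap.pi φ) := by
    induction j using WellFoundedLT.induction with | ind j ih =>
    have expansion := pi_eq_sum_univ' (LinearMap.pi φ (v j))
    rw [← add_sum_erase _ _ (mem_univ j), LinearMap.pi_apply, hdiag, one_smul] at expansion
    rw [eq_sub_of_add_eq expansion.symm]
    refine Submodule.sub_mem _ ⟨v j, rfl⟩ (Submodule.sum_mem _ fun i hi => ?_)
    by_cases h0 : φ i (v j) = 0
    · rw [LinearMap.pi_apply, h0, zero_smul]
      exact Submodule.zero_mem _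
    · exact Submodule.smul_mem _ _ (ih i ((htri i j h0).lt_of_ne (mem_erase.1 hi).1))
  intro y
  rw [← LinearMap.mem_range, pi_eq_sum_univ' y]
  exact Submodule.sum_mem _ fun i _ => Submodule.smul_mem _ _ (single_mem i)

section RowCounts

variable {ι : Type*} [PartialOrder ι] [WellFoundedLT ι] {n : ℕ} {p : n.Partition}
  {box : ι → ℕ × ℕ}

theorem IsColumnStandard.exists_eq_of_le (h : IsColumnStandard p box) {i : ι} {r : ℕ}
    (hr : r ≤ (box i).1) : ∃ j ≤ i, box j = (r, (box i).2) := by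
  induction i using WellFoundedLT.induction with | ind i ih =>
  rcases hr.eq_or_lt with rfl | hr
  · exact ⟨i, le_rfl, rfl⟩
  obtain ⟨r', hr'⟩ := Nat.exists_eq_add_one_of_ne_zero (Nat.ne_zero_of_lt hr)
  obtain ⟨i', hi', box_i'⟩ := h.exists_above i r' (box i).2 (Prod.ext hr' rfl)
  obtain ⟨j, hj, box_j⟩ := ih i' hi' (by simp only [box_i']; omega)
  exact ⟨j, hj.trans hi'.le, by rw [box_j, box_i']⟩

variable [LocallyFiniteOrderBot ι]

/-- The number of `i ≤ a` in the rows `0, …, k - 1`, where `s i` is the row of `i`. The pointwise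
order on `rowCount` is the dominance order on tabloids. -/
def rowCount (s : ι → ℕ) (a : ι) (k : ℕ) : ℕ := #{i ∈ Iic a | s i < k}

theorem rowCount_injective : Function.Injective (rowCount (ι := ι)) := by
  classical
  have rowCount_eq (s : ι → ℕ) (a : ι) (k : ℕ) :
      rowCount s a k = (if s a < k then 1 else 0) + #{i ∈ Iio a | s i < k} := by
    rw [rowCount, card_filter, ← Iio_insert, sum_insert notMem_Iio_self, ← card_filter]
  intro s u hsu
  funext a
  induction a using WellFoundedLT.induction with | ind a ih =>
  have below_eq (k : ℕ) : #{i ∈ Iio a | s i < k} = #{i ∈ Iio a | u i < k} :=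
    congrArg card (filter_congr fun i hi => by rw [ih i (mem_Iio.1 hi)])
  refine eq_of_forall_gt_iff fun k => ?_
  have count_eq := congrFun (congrFun hsu a) k
  rw [rowCount_eq, rowCount_eq, below_eq, Nat.add_right_cancel_iff] at count_eq
  split_ifs at count_eq <;> omega

namespace IsColumnStandard

-- The entries `≤ a` fill an initial segment of each column.
theorem min_card_column_le (h : IsColumnStandard p box) (a : ι) (k c : ℕ) :
    min k #{i ∈ Iic a | (box i).2 = c} ≤ #{i ∈ {i ∈ Iic a | (box i).1 < k} | (box i).2 = c} := by
  by_cases short : ∀ i ∈ Iic a, (box i).2 = c → (box i).1 < k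
  · refine (min_le_right _ _).trans (card_le_card fun i hi => ?_)
    obtain ⟨hia, hic⟩ := mem_filter.1 hi
    exact mem_filter.2 ⟨mem_filter.2 ⟨hia, short i hia hic⟩, hic⟩
  push Not at short
  obtain ⟨i, hia, rfl, hki⟩ := short
  refine (min_le_left _ _).trans ((card_range k).symm.trans_le
    (card_le_card_of_surjOn (fun j => (box j).1) fun r hr => ?_))
  have hrk : r < k := mem_range.1 hr
  obtain ⟨j, hj, box_j⟩ := h.exists_eq_of_le (hrk.le.trans hki)
  exact ⟨j, by simp [box_j, hrk, hj.trans (mem_Iic.1 hia)], congrArg Prod.fst box_j⟩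

theorem rowCount_le (h : IsColumnStandard p box) {s : ι → ℕ}
    (hs : ∀ i j, (box i).2 = (box j).2 → s i = s j → i = j) :
    rowCount s ≤ rowCount fun i => (box i).1 := by
  intro a k
  calc rowCount s a k
      ≤ ∑ c ∈ (Iic a).image (fun i => (box i).2), min k #{i ∈ Iic a | (box i).2 = c} :=
        card_filter_lt_le _ _ _ k fun i _ j _ => hs i j
    _ ≤ ∑ c ∈ (Iic a).image (fun i => (box i).2),
          #{i ∈ {i ∈ Iic a | (box i).1 < k} | (box i).2 = c} :=
        sum_le_sum fun c _ => h.min_card_column_le a k c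
    _ = rowCount (fun i => (box i).1) a k := (card_eq_sum_card_fiberwise fun i hi =>
        mem_image_of_mem _ (mem_filter.1 hi).1).symm

end IsColumnStandard

end RowCounts

section RobinsonSchenstedCoefficients

variable {R : Type*} [CommRing R] {n : ℕ}

theorem IsColumnStandard.exists_perm_eq {ι : Type*} [Finite ι] [LT ι] {p : n.Partition}
    {P Q : ι → ℕ × ℕ} (hP : IsColumnStandard p P) (hQ : IsColumnStandard p Q) :
    ∃ w : Equiv.Perm ι, ∀ i, P (w i) = Q i := by
  have exists_entry (i : ι) : ∃ a, P a = Q i :=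
    (hP.exists_eq_iff _ _).2 ((hQ.exists_eq_iff _ _).1 ⟨i, rfl⟩)
  choose w hw using exists_entry
  have w_injective : Function.Injective w := fun i j hij => hQ.injective (by rw [← hw, ← hw, hij])
  exact ⟨Equiv.ofBijective w (Finite.injective_iff_bijective.1 w_injective), hw⟩

theorem matrixCoeff_signedSum_mul_eq_one {ι α β : Type*} [Fintype ι] [DecidableEq ι]
    [DecidableEq α] [DecidableEq β] {P : ι → α × β} (hP : Function.Injective P)
    (w : Equiv.Perm ι) :
    matrixCoeff R (fun i => (P (w i)).1) (fun a => (P a).1)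
      (signedSum R (fun a => (P a).2) * MonoidAlgebra.of R _ w) = 1 := by
  rw [matrixCoeff_signedSum_mul, sum_eq_single 1]
  · simp
  · intro κ hκ hne
    rw [if_neg, smul_zero]
    refine fun hrow => hne (Equiv.ext fun a => hP (Prod.ext ?_ ((mem_filter.1 hκ).2 a)))
    simpa using hrow (w⁻¹ a)
  · simp

/-- The matrix coefficient of `M(rsShape σ)` at the rows of the recording and of the insertion
tableau of `σ`. -/
noncomputable def rsCoeff (R : Type*) [CommRing R] {n : ℕ} (σ : Equiv.Perm (Fin n)) :
    SymAlg R n →ₗ[R] R :=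
  matrixCoeff R (fun i => (recordingFilling σ i).1) (fun a => (insertionFilling σ a).1)

theorem rsCoeff_eq_zero {x : SymAlg R n} {σ : Equiv.Perm (Fin n)}
    (hx : ∀ m : PermModule R (rsShape σ), x • m = 0) : rsCoeff R σ x = 0 :=
  (forall_smul_permModule_eq_zero_iff _ x).1 hx _ _
    (isColumnStandard_recordingFilling σ).hasShape_fst
    (isColumnStandard_insertionFilling σ).hasShape_fst

theorem surjective_pi_rsCoeff (S : Set (Equiv.Perm (Fin n))) :
    Function.Surjective (LinearMap.pi fun σ : S => rsCoeff R (σ : Equiv.Perm (Fin n))) := by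
  choose w hw using fun σ : Equiv.Perm (Fin n) =>
    (isColumnStandard_insertionFilling σ).exists_perm_eq (isColumnStandard_recordingFilling σ)
  let rows (σ : S) : (Fin n → ℕ → ℕ) × (Fin n → ℕ → ℕ) :=
    (rowCount fun a => (insertionFilling σ.1 a).1, rowCount fun i => (recordingFilling σ.1 i).1)
  have rows_injective : Function.Injective rows := fun σ τ h =>
    Subtype.ext (eq_of_fillings_fst_eq (congrFun (rowCount_injective (Prod.ext_iff.1 h).1))
      (congrFun (rowCount_injective (Prod.ext_iff.1 h).2)))
  let _ : PartialOrder S := PartialOrder.lift rows rows_injective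
  refine surjective_pi_of_unitriangular _ (fun σ : S =>
    signedSum R (fun a => (insertionFilling σ.1 a).2) * MonoidAlgebra.of R _ (w σ.1))
    (fun σ => ?_) fun σ τ hne => ?_
  · simpa only [rsCoeff, hw] using
      matrixCoeff_signedSum_mul_eq_one (isColumnStandard_insertionFilling σ.1).injective (w σ.1)
  · refine ⟨(isColumnStandard_insertionFilling τ.1).rowCount_le fun a b => ?_,
      (isColumnStandard_recordingFilling τ.1).rowCount_le fun i j hcol => ?_⟩
    · exact eq_of_matrixCoeff_ne_zero hne
    · exact eq_of_matrixCoeff_ne_zero_right hne (by simp only [hw, hcol])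

end RobinsonSchenstedCoefficients

/-! ### The annihilator -/

section Complement

variable {R A ι : Type*} [CommRing R] [AddCommGroup A] [Module R A] {v : ι → A}
  {N : Submodule R A}

-- The composite `R^ι → A → R^ι` of `v` and `Φ` is surjective, hence injective.
theorem linearIndependent_and_isCompl_of_surjective [Finite ι] {Φ : A →ₗ[R] ι → R}
    (hΦ : Function.Surjective Φ) (hker : N ≤ LinearMap.ker Φ)
    (hsup : Submodule.span R (Set.range v) ⊔ N = ⊤) :
    LinearIndependent R v ∧ IsCompl (Submodule.span R (Set.range v)) N := by
  have := Fintype.ofFinite ι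
  let L : (ι → R) →ₗ[R] A := Fintype.linearCombination R v
  have range_L : LinearMap.range L = Submodule.span R (Set.range v) :=
    Fintype.range_linearCombination R v
  have comp_surjective : Function.Surjective (Φ ∘ₗ L) := by
    rw [← LinearMap.range_eq_top, LinearMap.range_comp, range_L, ← LinearMap.range_eq_top.2 hΦ,
      ← Submodule.map_top, ← hsup, Submodule.map_sup, LinearMap.le_ker_iff_map.1 hker,
      sup_bot_eq]
  have comp_injective : Function.Injective (Φ ∘ₗ L) :=
    OrzechProperty.injective_of_surjective_endomorphism _ comp_surjective
  refine ⟨linearIndependent_iff_injective_fintypeLinearCombination.2 (.of_comp comp_injective),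
    Submodule.disjoint_def.2 fun x hx hxN => ?_, codisjoint_iff.2 hsup⟩
  rw [← range_L] at hx
  obtain ⟨a, rfl⟩ := hx
  rw [comp_injective (a₂ := 0) ((hker hxN).trans (map_zero _).symm), map_zero]

theorem exists_basis_quotient_of_isCompl (hv : LinearIndependent R v)
    (hN : IsCompl (Submodule.span R (Set.range v)) N) :
    ∃ b : Module.Basis ι R (A ⧸ N), ∀ i, b i = Submodule.Quotient.mk (v i) :=
  ⟨(Module.Basis.span hv).map (Submodule.quotientEquivOfIsCompl N _ hN.symm).symm, fun i => by
    rw [Module.Basis.map_apply, Submodule.quotientEquivOfIsCompl_symm_apply,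
      Module.Basis.span_apply]⟩

end Complement

theorem exists_eq_Ici_of_existsUnique_minimal {α : Type*} [PartialOrder α] [Finite α] {s : Set α}
    (hs : IsUpperSet s) (hmin : ∃! a, Minimal (· ∈ s) a) : ∃ a, s = Set.Ici a := by
  obtain ⟨a, ha, unique⟩ := hmin
  refine ⟨a, Set.Subset.antisymm (fun b hb => ?_) fun b hab => hs hab ha.1⟩
  obtain ⟨c, hcb, hc⟩ := (Set.toFinite s).exists_le_minimal hb
  exact unique c hc ▸ hcb

section Annihilator

variable {R : Type*} [CommRing R] {n : ℕ} {Γ : Set n.Partition} {μ : n.Partition}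
  {M : Type*} [AddCommGroup M] [Module (SymAlg R n) M]

theorem mem_annihilator_iff (hM : IsYoungPermModuleOfType R Γ M) (x : SymAlg R n) :
    x ∈ Module.annihilator (SymAlg R n) M ↔ ∀ p ∈ Γ, ∀ m : PermModule R p, x • m = 0 := by
  classical
  obtain ⟨u, hu, ⟨e⟩⟩ := hM
  rw [e.annihilator_eq, Module.mem_annihilator]
  refine ⟨fun h p hp m => ?_, fun h y => DFinsupp.ext fun p => funext fun j => ?_⟩
  · let j : Fin (u p) := ⟨0, Nat.pos_of_ne_zero ((hu p).2 hp)⟩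
    have smul_lof := h (DirectSum.lof (SymAlg R n) _ (fun p => Fin (u p) → PermModule R p) p
      fun _ => m)
    rw [← map_smul] at smul_lof
    exact congrFun (DirectSum.of_injective p (smul_lof.trans (map_zero _).symm)) j
  · exact h p ((hu p).1 (Nat.ne_zero_of_lt j.isLt)) (y p j)

theorem daggerIdeal_le_annihilator (hΓ : IsUpperSet Γ) (hM : IsYoungPermModuleOfType R Γ M) :
    daggerIdeal R (transpose '' Γ)ᶜ ≤ (Module.annihilator (SymAlg R n) M).restrictScalars R := by
  rintro _ ⟨x, hx, rfl⟩
  exact (mem_annihilator_iff hM _).2 fun p hp m => dagger_smul_permModule_eq_zero hΓ hp hx m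

theorem annihilator_le_ker_rsCoeff (hM : IsYoungPermModuleOfType R Γ M) :
    (Module.annihilator (SymAlg R n) M).restrictScalars R ≤
      LinearMap.ker (LinearMap.pi fun σ : permsOfShape Γ => rsCoeff R (σ : Equiv.Perm (Fin n))) :=
  fun x hx => funext fun σ => rsCoeff_eq_zero ((mem_annihilator_iff hM x).1 hx _ σ.2)

theorem shapeSpan_eq_span_range (R : Type*) [CommRing R] (Γ : Set n.Partition) :
    shapeSpan R Γ = Submodule.span R (Set.range fun σ : permsOfShape Γ =>
      MonoidAlgebra.of R (Equiv.Perm (Fin n)) σ) := by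
  rw [shapeSpan, Set.image_eq_range]

theorem linearIndependent_and_isCompl_annihilator
    (hM : IsYoungPermModuleOfType R (Set.Ici μ) M) :
    LinearIndependent R (fun σ : permsOfShape (Set.Ici μ) =>
        MonoidAlgebra.of R (Equiv.Perm (Fin n)) σ) ∧
      IsCompl (shapeSpan R (Set.Ici μ))
        ((Module.annihilator (SymAlg R n) M).restrictScalars R) := by
  rw [shapeSpan_eq_span_range]
  refine linearIndependent_and_isCompl_of_surjective (surjective_pi_rsCoeff _)
    (annihilator_le_ker_rsCoeff hM) (top_le_iff.1 ?_)
  rw [← shapeSpan_eq_span_range, ← shapeSpan_sup_daggerIdeal μ]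
  exact sup_le_sup_left (daggerIdeal_le_annihilator (isUpperSet_Ici μ) hM) _

theorem annihilator_eq_daggerIdeal (hM : IsYoungPermModuleOfType R (Set.Ici μ) M) :
    (Module.annihilator (SymAlg R n) M).restrictScalars R =
      daggerIdeal R (transpose '' Set.Ici μ)ᶜ := by
  have hle := daggerIdeal_le_annihilator (isUpperSet_Ici μ) hM
  have disjoint := (linearIndependent_and_isCompl_annihilator hM).2.symm.inf_eq_bot
  refine (eq_of_le_of_inf_le_of_sup_le (z := shapeSpan R (Set.Ici μ)) hle
    (disjoint.trans_le bot_le) ?_).symm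
  rw [sup_comm (daggerIdeal R _), shapeSpan_sup_daggerIdeal]
  exact le_top

end Annihilator

end YoungPerm

open YoungPerm in
/-- `Γ ⊆ Par(n)` is co-saturated with a unique minimal element, `M` is a Young permutation module
of type `Γ` over `R Sym(n)`, and `Δ = Par(n) \ Γ*`. -/
theorem corollary2p10 {R : Type*} [CommRing R] {n : ℕ} (hn : 0 < n)
    (Γ : Set n.Partition) (hΓ : IsUpperSet Γ) (hmin : ∃! μ, Minimal (· ∈ Γ) μ)
    {M : Type*} [AddCommGroup M] [Module R M] [Module (SymAlg R n) M]
    [IsScalarTower R (SymAlg R n) M] (hM : IsYoungPermModuleOfType R Γ M) :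
    Function.Injective
        ((Algebra.lsmul R R M : SymAlg R n →ₐ[R] Module.End R M).toLinearMap.domRestrict
          (shapeSpan R Γ)) ∧
      (Module.annihilator (SymAlg R n) M : Set (SymAlg R n)) =
        dagger R n '' (youngIdeal R (transpose '' Γ)ᶜ : Set (SymAlg R n)) ∧
      ∃ b : Module.Basis (permsOfShape Γ) R (SymAlg R n ⧸ Module.annihilator (SymAlg R n) M),
        ∀ σ : permsOfShape Γ,
          b σ = Submodule.Quotient.mk (MonoidAlgebra.of R (Equiv.Perm (Fin n)) σ) := by
  obtain ⟨μ, rfl⟩ := exists_eq_Ici_of_existsUnique_minimal hΓ hmin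
  obtain ⟨independent, compl⟩ := linearIndependent_and_isCompl_annihilator hM
  refine ⟨?_, ?_, ?_⟩
  · have ker_lsmul : LinearMap.ker (Algebra.lsmul R R M : SymAlg R n →ₐ[R] _).toLinearMap =
        (Module.annihilator (SymAlg R n) M).restrictScalars R := by
      ext x
      simp [Module.mem_annihilator, LinearMap.ext_iff]
    rw [LinearMap.injective_domRestrict_iff, ker_lsmul]
    exact compl.disjoint
  · rw [← coe_daggerIdeal, ← annihilator_eq_daggerIdeal hM, Submodule.coe_restrictScalars]
  · rw [shapeSpan_eq_span_range] at compl
    obtain ⟨b, hb⟩ := exists_basis_quotient_of_isCompl independent compl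
    exact ⟨b.map (Submodule.Quotient.restrictScalarsEquiv R _), fun σ => by
      rw [Module.Basis.map_apply, hb, Submodule.Quotient.restrictScalarsEquiv_mk]⟩
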